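/- Let $d\ge 1$, let $L\ge 3$ be an odd integer, and for $N\ge 0$ let $\Lambda_N=\{x\in\mathbb Z^d:|x|_\infty\le \frac12(L^N-1)\}$ represent the discrete torus $(\mathbb Z/L^N\mathbb Z)^d$. On functions on this torus put $\nabla_i\varphi(x)=\varphi(x+e_i)-\varphi(x)$, $\nabla_i^*\varphi(x)=\varphi(x-e_i)-\varphi(x)$ and $(\varphi,\psi)=\sum_{x\in\Lambda_N}\varphi(x)\psi(x)$, and let $\chi_N$ be the space of functions with mean value zero. Let $q^N$ ($N\ge 0$) be symmetric real $d\times d$ matrices with Euclidean operator norm $\|q^N\|\le\frac12$. Then $\mathcal A^{q^N}=\sum_{i,j}(\delta_{ij}+q^N_{ij})\nabla_j^*\nabla_i$ is invertible on $\chi_N$; write $\mathcal C^{q^N}$ for its inverse. There are a symmetric matrix $\bar q$ and a subsequence $(N_k)$ with $\|q^{N_k}-\bar q\|\to 0$. Let $\bar q$ and $(N_k)$ be any matrix and any subsequence with $\|q^{N_k}-\bar q\|\to0$. For $J\in L^2(\mathbb R^d;\mathbb R^d)$ there is $u\in W^{1,2}_{\rm loc}(\mathbb R^d)$ with $Du\in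 L^2(\mathbb R^d;\mathbb R^d)$, unique up to an additive constant, such that $$-\sum_{i,j}(\delta_{ij}+\bar q_{ij})\,\partial_j\partial_i u=-\operatorname{div}J=:\operatorname{div}^*J$$ weakly on $\mathbb R^d$; write $D\mathcal C\operatorname{div}^*J:=Du$. Let $0<\alpha<1$, let $a,b\in\mathbb R^d$ and $Q(z)=z+(-\frac12,\frac12)^d$, and let $J_a,J_b\in L^2(\mathbb R^d;\mathbb R^d)$ have compact support in $Q(a)$ and $Q(b)$ respectively. For $z=a,b$ and $x\in\Lambda_N$ define $$J_z^N(x)=L^{-\alpha N\frac d2}\,J_z\!\left(\frac{x}{L^{\alpha N}}\right),$$ where the value of the $L^2$ class $J_z$ at $x/L^{\alpha N}$ means its average over the cube of side length $L^{-\alpha N}$ centred at $x/L^{\alpha N}$. Then, as $k\to\infty$ and with $N=N_k$, $$\Bigl(\sum_l\nabla_l^*J^{N}_{a,l},\ \mathcal C^{q^{N}}\sum_l\nabla_l^*J^{N}_{b,l}\Bigr)\longrightarrow\bigl(J_a,\,D\mathcal C\operatorname{div}^*J_b\bigr)_{L^2(\mathbb R^d;\mathbb R^d)} .$$ The same convergence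 holds with the point values $J_z(x/L^{\alpha N})$ in place of averages if $J_a,J_b$ are functions with compact support in $Q(a)$, $Q(b)$ that are bounded and continuous at almost every point (in particular if they are continuous). -/

import Mathlib

open MeasureTheory Filter Topology
open scoped ContDiff

namespace GradModel

/-- The space `ℝ^d` with its Euclidean norm. -/
abbrev E (d : ℕ) : Type := EuclideanSpace ℝ (Fin d)

/-! ### The discrete torus -/

/-- The discrete torus `(ℤ/nℤ)^d`; it is used with side length `n = L^N`. -/
abbrev Torus (d n : ℕ) : Type := Fin d → ZMod n

/-- The representative of a point of the torus in the centred cube `Λ ⊆ ℤ^d`. For odd `n` its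
coordinates are the integers of absolute value at most `(n - 1) / 2`. -/
noncomputable def pos {d n : ℕ} (x : Torus d n) : E d :=
  WithLp.toLp 2 (fun i => ((x i).valMinAbs : ℝ))

/-- Forward difference `∇_i φ(x) = φ(x + e_i) - φ(x)`. -/
def fwd {d n : ℕ} (i : Fin d) (φ : Torus d n → ℝ) : Torus d n → ℝ :=
  fun x => φ (x + Pi.single i 1) - φ x

/-- Adjoint difference `∇_i^* φ(x) = φ(x - e_i) - φ(x)`. -/
def adj {d n : ℕ} (i : Fin d) (φ : Torus d n → ℝ) : Torus d n → ℝ :=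
  fun x => φ (x - Pi.single i 1) - φ x

theorem sum_adj {d n : ℕ} [NeZero n] (i : Fin d) (φ : Torus d n → ℝ) :
    ∑ x, adj i φ x = 0 := by
  have h := (Equiv.subRight (Pi.single i 1 : Torus d n)).sum_comp φ
  simp only [Equiv.subRight_apply] at h
  simp [adj, Finset.sum_sub_distrib, h]

/-- The space `χ` of functions on the torus with mean value zero. -/
def meanZero (d n : ℕ) [NeZero n] : Submodule ℝ (Torus d n → ℝ) where
  carrier := {φ | ∑ x, φ x = 0}
  add_mem' := by
    intro φ ψ hφ hψ
    simp only [Set.mem_ofPred_eq] at *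
    simp [Finset.sum_add_distrib, hφ, hψ]
  zero_mem' := by simp
  smul_mem' := by
    intro c φ hφ
    simp only [Set.mem_ofPred_eq] at *
    simp [← Finset.mul_sum, hφ]

/-- The operator `𝒜^q = ∑_{i,j} (δ_ij + q_ij) ∇_j^* ∇_i` on the functions of mean value zero. -/
noncomputable def opA {d n : ℕ} [NeZero n] (q : Matrix (Fin d) (Fin d) ℝ) :
    Module.End ℝ (meanZero d n) where
  toFun φ := ⟨fun x => ∑ i, ∑ j, (1 + q) i j * adj j (fwd i φ.1) x, by
    change ∑ x, ∑ i, ∑ j, (1 + q) i j * adj j (fwd i φ.1) x = 0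
    rw [Finset.sum_comm]
    refine Finset.sum_eq_zero fun i _ => ?_
    rw [Finset.sum_comm]
    refine Finset.sum_eq_zero fun j _ => ?_
    rw [← Finset.mul_sum, sum_adj, mul_zero]⟩
  map_add' φ ψ := by
    ext x
    simp only [adj, fwd, Submodule.coe_add, Pi.add_apply, ← Finset.sum_add_distrib]
    refine Finset.sum_congr rfl fun i _ => Finset.sum_congr rfl fun j _ => ?_
    ring
  map_smul' c φ := by
    ext x
    simp only [adj, fwd, Submodule.coe_smul, Pi.smul_apply, smul_eq_mul, Finset.mul_sum,
      RingHom.id_apply]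
    refine Finset.sum_congr rfl fun i _ => Finset.sum_congr rfl fun j _ => ?_
    ring

/-- The covariance `𝒞^q = (𝒜^q)⁻¹` on the functions of mean value zero
(meaningful when `opA q` is invertible). -/
noncomputable def covC {d n : ℕ} [NeZero n] (q : Matrix (Fin d) (Fin d) ℝ) :
    Module.End ℝ (meanZero d n) :=
  Ring.inverse (opA q)

/-- `∑_l ∇_l^* h_l` for a vector field `h` on the torus; it has mean value zero. -/
noncomputable def divStar {d n : ℕ} [NeZero n] (h : Torus d n → E d) : meanZero d n :=
  ⟨fun x => ∑ l, adj l (fun y => h y l) x, by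
    change ∑ x, ∑ l, adj l (fun y => h y l) x = 0
    rw [Finset.sum_comm]
    exact Finset.sum_eq_zero fun l _ => sum_adj l _⟩

/-- The scalar product `(φ, ψ) = ∑_x φ(x) ψ(x)`. -/
noncomputable def pairing {d n : ℕ} [NeZero n] (φ ψ : meanZero d n) : ℝ :=
  ∑ x, φ.1 x * ψ.1 x

/-- The quadratic quantity `(∑_l ∇_l^* h_l, 𝒞^q ∑_l ∇_l^* k_l)`. -/
noncomputable def covForm {d n : ℕ} [NeZero n] (q : Matrix (Fin d) (Fin d) ℝ)
    (h k : Torus d n → E d) : ℝ :=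
  pairing (divStar h) (covC q (divStar k))

/-- The operator norm of `q` on Euclidean `ℝ^d`. -/
noncomputable def opNorm {d : ℕ} (q : Matrix (Fin d) (Fin d) ℝ) : ℝ :=
  ‖Matrix.toEuclideanCLM (n := Fin d) (𝕜 := ℝ) q‖

/-! ### Rescaled fields -/

/-- The open cube of side length `s` centred at `z`; `Q(z) = cube z 1`. -/
def cube {d : ℕ} (z : E d) (s : ℝ) : Set (E d) := {y | ∀ i, |y i - z i| < s / 2}

/-- The rescaled field `J^N(x) = L^{-αNd/2} J(x / L^{αN})`, `x ∈ Λ_N`, by point values of `J`. -/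
noncomputable def sampled {d : ℕ} (L : ℕ) (α : ℝ) (N : ℕ) (J : E d → E d) :
    Torus d (L ^ N) → E d :=
  fun x => (L : ℝ) ^ (-(α * N * d / 2)) • J ((L : ℝ) ^ (-(α * N)) • pos x)

/-- The rescaled field `J^N` for a class `J ∈ L²`, which has no point values: the value of `J` at
`x / L^{αN}` is its mean over the lattice cell of side length `L^{-αN}` centred there. -/
noncomputable def averaged {d : ℕ} (L : ℕ) (α : ℝ) (N : ℕ) (J : E d → E d) :
    Torus d (L ^ N) → E d :=
  fun x => (L : ℝ) ^ (-(α * N * d / 2)) •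
    ⨍ y in cube ((L : ℝ) ^ (-(α * N)) • pos x) ((L : ℝ) ^ (-(α * N))), J y

/-! ### The equation on the whole space -/

/-- The partial derivative `∂_i ψ`. -/
noncomputable def pd {d : ℕ} (i : Fin d) (ψ : E d → ℝ) (y : E d) : ℝ :=
  fderiv ℝ ψ y (EuclideanSpace.single i 1)

/-- Smooth compactly supported test functions. -/
def IsTest {d : ℕ} (ψ : E d → ℝ) : Prop := ContDiff ℝ ∞ ψ ∧ HasCompactSupport ψ

/-- `u ∈ W^{1,2}_loc(ℝ^d)` with weak gradient `v = Du ∈ L²(ℝ^d)` is a weak solution of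
`∑_{i,j} a_ij ∂_j^* ∂_i u = div^* J` on `ℝ^d`, where `∂_j^* = -∂_j` and `div^* = -div`. -/
structure IsSolution {d : ℕ} (a : Matrix (Fin d) (Fin d) ℝ) (J : E d → E d)
    (u : E d → ℝ) (v : E d → E d) : Prop where
  memLp_loc : ∀ K : Set (E d), IsCompact K → MemLp u 2 (volume.restrict K)
  memLp_grad : MemLp v 2 volume
  weak_grad : ∀ ψ : E d → ℝ, IsTest ψ → ∀ i,
    ∫ y, u y * pd i ψ y = - ∫ y, v y i * ψ y
  equation : ∀ ψ : E d → ℝ, IsTest ψ →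
    ∫ y, ∑ i, ∑ j, a i j * v y i * pd j ψ y = ∫ y, ∑ j, J y j * pd j ψ y

/-- `J ∈ L²(ℝ^d; ℝ^d)` has compact support in `Q(z)`, as a class of functions. -/
def SuppL2 {d : ℕ} (z : E d) (J : E d → E d) : Prop :=
  MemLp J 2 volume ∧ ∃ K : Set (E d), IsCompact K ∧ K ⊆ cube z 1 ∧ ∀ᵐ y, y ∉ K → J y = 0

/-- `J` is bounded, continuous at almost every point and has compact support in `Q(z)`, as a
function; this includes every continuous `J` with compact support in `Q(z)`. -/
def SuppReg {d : ℕ} (z : E d) (J : E d → E d) : Prop :=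
  (∃ M : ℝ, ∀ y, ‖J y‖ ≤ M) ∧ (∀ᵐ y, ContinuousAt J y) ∧
    HasCompactSupport J ∧ tsupport J ⊆ cube z 1

end GradModel

/-!
The operator `𝒜^q` is symmetric and coercive on discrete gradients, because `‖q‖ ≤ 1/2`; this gives
its invertibility (`isUnit_opA`) and the energy estimate `‖∇φ‖ ≤ 2 ‖k‖` in `ℓ²` for the solution
of `𝒜^q φ = ∑ ∇_l^* k_l` (`l2norm_covGrad_le`). Summation by parts turns the covariance form into
`∑_x h(x) · ∇φ(x)` (`covForm_eq`).

For the limit, the solutions `φ_k` belonging to the averages of `J_b` are fixed and the pairing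
`ℓ_k(F) = ∑_x avg F(x) · ∇φ_k(x)` is regarded as a linear functional of `F ∈ L²(ℝ^d; ℝ^d)`. Averaging
over cells is a contraction from `L²` to `ℓ²`, so the functionals `ℓ_k` are uniformly bounded, and
their convergence has to be checked on a total set only (`tendsto_inner_of_total`). The set
consists of

* the fields `∂_jψ e_i - ∂_iψ e_j`: in the limit the discrete gradients are orthogonal to them,
  since differences in two directions commute (`tendsto_sum_inner_curl`);
* the fields `A∇ψ` with `A = 1 + qbar`: here the discrete equation tested with the restriction of `ψ`
  to the lattice gives the limit `∫ J_b · ∇ψ` (`tendsto_sum_inner_equation`).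

On both the limit agrees with the pairing with `v = Du`. No compactness argument is needed. That the
set is total is a Liouville theorem (`ae_eq_zero_of_curl_free`): a square integrable field orthogonal
to it is curl free and solves the homogeneous equation. After mollification each of its components
solves `∑ A_ij ∂_i ∂_j h = 0` and tends to zero at infinity, so it vanishes by the maximum principle.
The same theorem gives uniqueness for the equation on `ℝ^d`.

Existence on `ℝ^d` follows from the Lax–Milgram theorem in the closure of the gradients of test
functions. A potential `u` of the field so obtained comes from a Poincaré inequality with the weight
`(1 + |x|)^{-(d+3)}` on the whole space (`exists_poincare`), which makes the test functions, with their
weighted means subtracted, a Cauchy sequence in the weighted `L²` space; this works in every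
dimension.

Point values of a bounded, almost everywhere continuous field differ from the averages by an error
that vanishes in `ℓ²`, by dominated convergence (`SampleConv.tendsto_l2norm`), so both versions of the
statement have the same limit. Difference quotients of test functions are compared with averages of
derivatives in the same way.
-/

namespace GradModel

/-! ### Quadratic forms -/

theorem sum_mul_eq_inner {d : ℕ} (q : Matrix (Fin d) (Fin d) ℝ) (s t : E d) :
    ∑ i, ∑ j, q i j * s i * t j = inner ℝ s (Matrix.toEuclideanCLM (n := Fin d) (𝕜 := ℝ) q t) := by
  rw [Matrix.inner_toEuclideanCLM]
  simp only [dotProduct, Matrix.mulVec, Finset.mul_sum]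
  exact Finset.sum_congr rfl fun i _ => Finset.sum_congr rfl fun j _ => by ring

theorem abs_sum_mul_le {d : ℕ} (q : Matrix (Fin d) (Fin d) ℝ) (s t : E d) :
    |∑ i, ∑ j, q i j * s i * t j| ≤ opNorm q * ‖s‖ * ‖t‖ := by
  rw [sum_mul_eq_inner]
  refine (abs_real_inner_le_norm _ _).trans ?_
  have := (Matrix.toEuclideanCLM (n := Fin d) (𝕜 := ℝ) q).le_opNorm t
  calc _ ≤ ‖s‖ * (opNorm q * ‖t‖) := by gcongr; exact this
    _ = _ := by ring

theorem sum_one_add_mul {d : ℕ} (q : Matrix (Fin d) (Fin d) ℝ) (s t : E d) :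
    ∑ i, ∑ j, (1 + q) i j * s i * t j = inner ℝ s t + ∑ i, ∑ j, q i j * s i * t j := by
  rw [sum_mul_eq_inner, sum_mul_eq_inner, map_add, map_one, add_apply, inner_add_right]
  rfl

/-- The matrix `1 + q` is coercive when `q` has operator norm at most `1 / 2`. -/
theorem half_norm_sq_le {d : ℕ} {q : Matrix (Fin d) (Fin d) ℝ} (hq : opNorm q ≤ 1 / 2) (s : E d) :
    1 / 2 * ‖s‖ ^ 2 ≤ ∑ i, ∑ j, (1 + q) i j * s i * s j := by
  rw [sum_one_add_mul, real_inner_self_eq_norm_sq]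
  have h1 := (abs_le.1 (abs_sum_mul_le q s s)).1
  nlinarith [mul_le_mul_of_nonneg_right hq (sq_nonneg ‖s‖)]

theorem abs_entry_le {d : ℕ} (q : Matrix (Fin d) (Fin d) ℝ) (i j : Fin d) :
    |q i j| ≤ opNorm q := by
  have h := abs_sum_mul_le q (EuclideanSpace.single i 1) (EuclideanSpace.single j 1)
  rw [sum_mul_eq_inner, Matrix.inner_toEuclideanCLM] at h
  simpa using h

theorem opNorm_nonneg {d : ℕ} (q : Matrix (Fin d) (Fin d) ℝ) : 0 ≤ opNorm q := norm_nonneg _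

theorem isSymm_of_tendsto {d : ℕ} {q : ℕ → Matrix (Fin d) (Fin d) ℝ}
    {qbar : Matrix (Fin d) (Fin d) ℝ} (hsymm : ∀ N, (q N).IsSymm)
    (h : Tendsto (fun k => opNorm (q k - qbar)) atTop (𝓝 0)) : qbar.IsSymm := by
  have hent : ∀ i j, Tendsto (fun k => q k i j) atTop (𝓝 (qbar i j)) := by
    intro i j
    rw [tendsto_iff_norm_sub_tendsto_zero]
    exact squeeze_zero (fun _ => norm_nonneg _) (fun k => abs_entry_le (q k - qbar) i j) h
  refine Matrix.IsSymm.ext fun i j => ?_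
  refine tendsto_nhds_unique (hent j i) ((hent i j).congr fun k => ?_)
  exact (hsymm k).apply j i

theorem opNorm_le_of_tendsto {d : ℕ} {q : ℕ → Matrix (Fin d) (Fin d) ℝ}
    {qbar : Matrix (Fin d) (Fin d) ℝ} {C : ℝ} (hq : ∀ N, opNorm (q N) ≤ C)
    (h : Tendsto (fun k => opNorm (q k - qbar)) atTop (𝓝 0)) : opNorm qbar ≤ C := by
  have h' : Tendsto (fun k => Matrix.toEuclideanCLM (n := Fin d) (𝕜 := ℝ) (q k)) atTop
      (𝓝 (Matrix.toEuclideanCLM (n := Fin d) (𝕜 := ℝ) qbar)) := by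
    rw [tendsto_iff_norm_sub_tendsto_zero]
    simpa only [opNorm, map_sub] using h
  exact le_of_tendsto h'.norm (Eventually.of_forall hq)

theorem exists_subseq_tendsto {d : ℕ} {q : ℕ → Matrix (Fin d) (Fin d) ℝ} {C : ℝ}
    (hq : ∀ N, opNorm (q N) ≤ C) :
    ∃ (qbar : Matrix (Fin d) (Fin d) ℝ) (κ : ℕ → ℕ), StrictMono κ ∧
      Tendsto (fun k => opNorm (q (κ k) - qbar)) atTop (𝓝 0) := by
  have : ProperSpace (E d →L[ℝ] E d) := FiniteDimensional.proper ℝ _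
  obtain ⟨T, -, κ, hκ, hT⟩ := tendsto_subseq_of_bounded
    (x := fun N => Matrix.toEuclideanCLM (n := Fin d) (𝕜 := ℝ) (q N))
    (Metric.isBounded_closedBall (x := (0 : E d →L[ℝ] E d)) (r := C))
    (fun N => by rw [mem_closedBall_zero_iff]; exact hq N)
  refine ⟨(Matrix.toEuclideanCLM (n := Fin d) (𝕜 := ℝ)).symm T, κ, hκ, ?_⟩
  rw [tendsto_iff_norm_sub_tendsto_zero] at hT
  simpa only [opNorm, map_sub, StarAlgEquiv.apply_symm_apply, Function.comp_apply] using hT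

/-! ### Fields on the discrete torus -/

/-- The discrete gradient `(∇_1 φ, …, ∇_d φ)`. -/
def grad {d n : ℕ} (φ : Torus d n → ℝ) (x : Torus d n) : E d := WithLp.toLp 2 fun i => fwd i φ x

@[simp] theorem grad_apply {d n : ℕ} (φ : Torus d n → ℝ) (x : Torus d n) (i : Fin d) :
    grad φ x i = fwd i φ x := rfl

section Discrete

variable {d n : ℕ} [NeZero n]

/-- The `ℓ²` norm of a vector field on the torus. -/
noncomputable def l2norm (h : Torus d n → E d) : ℝ := √(∑ x, ‖h x‖ ^ 2)

theorem l2norm_nonneg (h : Torus d n → E d) : 0 ≤ l2norm h := Real.sqrt_nonneg _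

theorem l2norm_sq (h : Torus d n → E d) : l2norm h ^ 2 = ∑ x, ‖h x‖ ^ 2 :=
  Real.sq_sqrt (Finset.sum_nonneg fun _ _ => sq_nonneg _)

theorem sum_norm_mul_norm_le (h k : Torus d n → E d) :
    ∑ x, ‖h x‖ * ‖k x‖ ≤ l2norm h * l2norm k :=
  Real.sum_mul_le_sqrt_mul_sqrt _ _ _

theorem abs_sum_inner_le (h k : Torus d n → E d) :
    |∑ x, inner ℝ (h x) (k x)| ≤ l2norm h * l2norm k :=
  (Finset.abs_sum_le_sum_abs _ _).trans <|
    (Finset.sum_le_sum fun x _ => abs_real_inner_le_norm (h x) (k x)).trans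
      (sum_norm_mul_norm_le h k)

theorem l2norm_le_add_sub (h k : Torus d n → E d) :
    l2norm h ≤ l2norm k + l2norm (fun x => h x - k x) := by
  refine Real.sqrt_le_iff.2 ⟨add_nonneg (l2norm_nonneg _) (l2norm_nonneg _), ?_⟩
  calc ∑ x, ‖h x‖ ^ 2
      ≤ ∑ x, (‖k x‖ ^ 2 + 2 * (‖k x‖ * ‖h x - k x‖) + ‖h x - k x‖ ^ 2) := by
        refine Finset.sum_le_sum fun x _ => ?_
        have h1 : ‖h x‖ ≤ ‖k x‖ + ‖h x - k x‖ := by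
          simpa using norm_add_le (k x) (h x - k x)
        nlinarith [norm_nonneg (h x), norm_nonneg (k x), norm_nonneg (h x - k x)]
    _ = l2norm k ^ 2 + 2 * ∑ x, ‖k x‖ * ‖h x - k x‖ + l2norm (fun x => h x - k x) ^ 2 := by
        rw [l2norm_sq, l2norm_sq, Finset.sum_add_distrib, Finset.sum_add_distrib, Finset.mul_sum]
    _ ≤ _ := by
        nlinarith [sum_norm_mul_norm_le k (fun x => h x - k x)]

theorem sum_shift (i : Fin d) (f : Torus d n → ℝ) :
    ∑ x : Torus d n, f (x - Pi.single i 1) = ∑ x, f x :=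
  (Equiv.subRight (Pi.single i 1 : Torus d n)).sum_comp f

/-- Summation by parts. -/
theorem sum_adj_mul (i : Fin d) (φ ψ : Torus d n → ℝ) :
    ∑ x, adj i φ x * ψ x = ∑ x, φ x * fwd i ψ x := by
  have h := sum_shift i fun x => φ x * ψ (x + Pi.single i 1)
  simp only [sub_add_cancel] at h
  simp only [adj, fwd, sub_mul, mul_sub, Finset.sum_sub_distrib, h]

/-- The differences in two directions commute; this is the discrete form of `curl ∇φ = 0`. -/
theorem sum_adj_mul_fwd_comm (i j : Fin d) (φ ψ : Torus d n → ℝ) :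
    ∑ x, adj j ψ x * fwd i φ x = ∑ x, adj i ψ x * fwd j φ x := by
  rw [sum_adj_mul, sum_adj_mul]
  refine Finset.sum_congr rfl fun x _ => ?_
  simp only [fwd]
  rw [add_right_comm x]
  ring

theorem sum_mul_opA (q : Matrix (Fin d) (Fin d) ℝ) (ψ : Torus d n → ℝ) (φ : meanZero d n) :
    ∑ x, ψ x * (opA q φ).1 x = ∑ x, ∑ i, ∑ j, (1 + q) i j * grad φ.1 x i * grad ψ x j := by
  have h : ∀ x, ψ x * (opA q φ).1 x =
      ∑ i, ∑ j, (1 + q) i j * (adj j (fwd i φ.1) x * ψ x) := by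
    intro x
    change ψ x * ∑ i, ∑ j, (1 + q) i j * adj j (fwd i φ.1) x = _
    simp only [Finset.mul_sum]
    exact Finset.sum_congr rfl fun i _ => Finset.sum_congr rfl fun j _ => by ring
  simp only [h]
  rw [Finset.sum_comm, Finset.sum_comm (s := Finset.univ (α := Torus d n))]
  refine Finset.sum_congr rfl fun i _ => ?_
  rw [Finset.sum_comm, Finset.sum_comm (s := Finset.univ (α := Torus d n))]
  refine Finset.sum_congr rfl fun j _ => ?_
  rw [← Finset.mul_sum, sum_adj_mul, Finset.mul_sum]
  exact Finset.sum_congr rfl fun x _ => by simp only [grad_apply]; ring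

theorem sum_mul_divStar (h : Torus d n → E d) (ψ : Torus d n → ℝ) :
    ∑ x, (divStar h).1 x * ψ x = ∑ x, inner ℝ (h x) (grad ψ x) := by
  change ∑ x, (∑ l, adj l (fun y => h y l) x) * ψ x = _
  simp only [Finset.sum_mul]
  rw [Finset.sum_comm]
  simp only [sum_adj_mul]
  rw [Finset.sum_comm]
  refine Finset.sum_congr rfl fun x _ => ?_
  simp only [PiLp.inner_apply, grad_apply]
  exact Finset.sum_congr rfl fun i _ => by simp [mul_comm]

/-- A function on the torus with vanishing gradient is constant. -/
theorem eq_of_fwd_eq_zero {φ : Torus d n → ℝ} (h : ∀ i x, fwd i φ x = 0) (x : Torus d n) :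
    φ x = φ 0 := by
  have hstep : ∀ i (k : ℕ) (y : Torus d n), φ (y + Pi.single i (k : ZMod n)) = φ y := by
    intro i k
    induction k with
    | zero => intro y; simp
    | succ k ih =>
      intro y
      rw [Nat.cast_succ, Pi.single_add, ← add_assoc, ← ih y]
      exact sub_eq_zero.1 (h i _)
  have hsum : ∀ s : Finset (Fin d), φ (∑ i ∈ s, Pi.single i (x i)) = φ 0 := by
    intro s
    induction s using Finset.induction_on with
    | empty => simp
    | insert i s hi ih =>
      rw [Finset.sum_insert hi, add_comm, ← ih]
      have := hstep i (x i).val (∑ i ∈ s, Pi.single i (x i))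
      rwa [ZMod.natCast_zmod_val] at this
  have := hsum Finset.univ
  rwa [Finset.univ_sum_single] at this

theorem half_l2norm_sq_le {q : Matrix (Fin d) (Fin d) ℝ} (hq : opNorm q ≤ 1 / 2)
    (φ : meanZero d n) : 1 / 2 * l2norm (grad φ.1) ^ 2 ≤ ∑ x, φ.1 x * (opA q φ).1 x := by
  rw [sum_mul_opA, l2norm_sq, Finset.mul_sum]
  exact Finset.sum_le_sum fun x _ => half_norm_sq_le hq _

theorem isUnit_opA {q : Matrix (Fin d) (Fin d) ℝ} (hq : opNorm q ≤ 1 / 2) :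
    IsUnit (opA (d := d) (n := n) q) := by
  rw [LinearMap.isUnit_iff_ker_eq_bot, LinearMap.ker_eq_bot']
  intro φ hφ
  have h1 := half_l2norm_sq_le hq φ
  rw [hφ] at h1
  have h2 : l2norm (grad φ.1) ^ 2 = 0 := by
    refine le_antisymm ?_ (sq_nonneg _)
    have h2 : ∑ x, φ.1 x * (0 : meanZero d n).1 x = 0 := by simp
    linarith
  rw [l2norm_sq, Finset.sum_eq_zero_iff_of_nonneg fun _ _ => sq_nonneg _] at h2
  have h3 : ∀ x, φ.1 x = φ.1 0 := by
    refine eq_of_fwd_eq_zero fun i x => ?_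
    have h4 : grad φ.1 x = 0 := by simpa using h2 x (Finset.mem_univ x)
    rw [← grad_apply, h4]; rfl
  have h5 : ∑ x, φ.1 x = 0 := φ.2
  simp only [h3, Finset.sum_const, nsmul_eq_mul, mul_eq_zero, Nat.cast_eq_zero] at h5
  have h6 : φ.1 0 = 0 := h5.resolve_left (by rw [Finset.card_univ]; exact Fintype.card_ne_zero)
  ext x
  rw [h3 x, h6]; rfl

theorem opA_covC {q : Matrix (Fin d) (Fin d) ℝ} (hq : opNorm q ≤ 1 / 2) (f : meanZero d n) :
    opA q (covC q f) = f := by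
  have := Ring.mul_inverse_cancel _ (isUnit_opA (n := n) hq)
  exact congrArg (fun T : Module.End ℝ (meanZero d n) => T f) this

/-- The gradient of the solution of `𝒜^q φ = ∑_l ∇_l^* k_l`. -/
noncomputable def covGrad (q : Matrix (Fin d) (Fin d) ℝ) (k : Torus d n → E d) :
    Torus d n → E d := grad (covC q (divStar k)).1

theorem covForm_eq (q : Matrix (Fin d) (Fin d) ℝ) (h k : Torus d n → E d) :
    covForm q h k = ∑ x, inner ℝ (h x) (covGrad q k x) :=
  sum_mul_divStar h _

/-- The discrete equation, in weak form. -/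
theorem sum_covGrad_mul_grad {q : Matrix (Fin d) (Fin d) ℝ} (hq : opNorm q ≤ 1 / 2)
    (k : Torus d n → E d) (ψ : Torus d n → ℝ) :
    ∑ x, ∑ i, ∑ j, (1 + q) i j * covGrad q k x i * grad ψ x j =
      ∑ x, inner ℝ (k x) (grad ψ x) := by
  rw [← sum_mul_divStar, covGrad, ← sum_mul_opA, opA_covC hq]
  exact Finset.sum_congr rfl fun x _ => mul_comm _ _

/-- The energy estimate. -/
theorem l2norm_covGrad_le {q : Matrix (Fin d) (Fin d) ℝ} (hq : opNorm q ≤ 1 / 2)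
    (k : Torus d n → E d) : l2norm (covGrad q k) ≤ 2 * l2norm k := by
  have h1 := half_l2norm_sq_le hq (covC q (divStar k))
  rw [opA_covC hq] at h1
  simp only [mul_comm ((covC q (divStar k)).1 _)] at h1
  rw [sum_mul_divStar] at h1
  have h2 := h1.trans ((le_abs_self _).trans (abs_sum_inner_le k _))
  change 1 / 2 * l2norm (covGrad q k) ^ 2 ≤ l2norm k * l2norm (covGrad q k) at h2
  rcases (l2norm_nonneg (covGrad q k)).eq_or_lt with h3 | h3
  · rw [← h3]; have := l2norm_nonneg k; positivity
  · nlinarith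

theorem divStar_sub (h k : Torus d n → E d) :
    divStar (fun x => h x - k x) = divStar h - divStar k := by
  ext x
  change ∑ l, adj l (fun y => (h y - k y) l) x =
    ∑ l, adj l (fun y => h y l) x - ∑ l, adj l (fun y => k y l) x
  rw [← Finset.sum_sub_distrib]
  refine Finset.sum_congr rfl fun l _ => ?_
  simp only [adj, PiLp.sub_apply]
  ring

theorem covGrad_sub (q : Matrix (Fin d) (Fin d) ℝ) (h k : Torus d n → E d) (x : Torus d n) :
    covGrad q (fun x => h x - k x) x = covGrad q h x - covGrad q k x := by
  ext i
  simp only [covGrad, divStar_sub, map_sub, PiLp.sub_apply, grad_apply, fwd]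
  simp only [Submodule.coe_sub, Pi.sub_apply]
  ring

/-- The covariance form is Lipschitz in its two arguments. -/
theorem abs_covForm_sub_le {q : Matrix (Fin d) (Fin d) ℝ} (hq : opNorm q ≤ 1 / 2)
    (h k h' k' : Torus d n → E d) :
    |covForm q h k - covForm q h' k'| ≤
      2 * l2norm (fun x => h x - h' x) * l2norm k +
        2 * l2norm h' * l2norm (fun x => k x - k' x) := by
  have key : covForm q h k - covForm q h' k' =
      ∑ x, inner ℝ (h x - h' x) (covGrad q k x) +
        ∑ x, inner ℝ (h' x) (covGrad q (fun x => k x - k' x) x) := by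
    rw [covForm_eq, covForm_eq, ← Finset.sum_sub_distrib, ← Finset.sum_add_distrib]
    refine Finset.sum_congr rfl fun x _ => ?_
    rw [covGrad_sub, inner_sub_left, inner_sub_right]
    ring
  rw [key]
  refine (abs_add_le _ _).trans (add_le_add ?_ ?_)
  · refine (abs_sum_inner_le (fun x => h x - h' x) _).trans ?_
    have := l2norm_covGrad_le hq k
    nlinarith [l2norm_nonneg (fun x => h x - h' x)]
  · refine (abs_sum_inner_le _ _).trans ?_
    have := l2norm_covGrad_le hq (fun x => k x - k' x)
    nlinarith [l2norm_nonneg h']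

end Discrete

/-! ### Partial derivatives -/

section Calculus

variable {d : ℕ}

theorem contDiff_pd {ψ : E d → ℝ} (h : ContDiff ℝ ∞ ψ) (i : Fin d) : ContDiff ℝ ∞ (pd i ψ) :=
  (h.fderiv_right (m := ∞) le_rfl).clm_apply contDiff_const

theorem hasCompactSupport_pd {ψ : E d → ℝ} (h : HasCompactSupport ψ) (i : Fin d) :
    HasCompactSupport (pd i ψ) :=
  (h.fderiv (𝕜 := ℝ)).comp_left (g := fun T : E d →L[ℝ] ℝ => T (EuclideanSpace.single i 1)) rfl

theorem IsTest.pd {ψ : E d → ℝ} (h : IsTest ψ) (i : Fin d) : IsTest (pd i ψ) :=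
  ⟨contDiff_pd h.1 i, hasCompactSupport_pd h.2 i⟩

theorem differentiable_of_contDiff {ψ : E d → ℝ} (h : ContDiff ℝ ∞ ψ) : Differentiable ℝ ψ :=
  h.differentiable (by simp)

theorem fderiv_eq_sum_pd (ψ : E d → ℝ) (x v : E d) : fderiv ℝ ψ x v = ∑ i, v i * pd i ψ x := by
  conv_lhs => rw [← (EuclideanSpace.basisFun (Fin d) ℝ).sum_repr v]
  simp [pd]

theorem pd_comm {ψ : E d → ℝ} (h : ContDiff ℝ ∞ ψ) (i j : Fin d) (x : E d) :
    pd i (pd j ψ) x = pd j (pd i ψ) x := by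
  have hd : DifferentiableAt ℝ (fderiv ℝ ψ) x :=
    ((h.fderiv_right (m := ∞) le_rfl).differentiable (by simp)) x
  have hs : IsSymmSndFDerivAt ℝ ψ x :=
    h.contDiffAt.isSymmSndFDerivAt (by simpa using WithTop.coe_le_coe.2 (le_top : (2 : ℕ∞) ≤ ⊤))
  have key : ∀ k l : Fin d, pd k (pd l ψ) x =
      fderiv ℝ (fderiv ℝ ψ) x (EuclideanSpace.single k 1) (EuclideanSpace.single l 1) := by
    intro k l
    have : pd l ψ = fun y => fderiv ℝ ψ y (EuclideanSpace.single l 1) := rfl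
    rw [this, GradModel.pd, fderiv_clm_apply hd (differentiableAt_const _)]
    simp
  rw [key, key]
  exact hs.eq _ _

theorem pd_sum_const_mul {ι : Type*} (s : Finset ι) (c : ι → ℝ) {f : ι → E d → ℝ}
    (hf : ∀ j, Differentiable ℝ (f j)) (i : Fin d) (x : E d) :
    pd i (fun y => ∑ j ∈ s, c j * f j y) x = ∑ j ∈ s, c j * pd i (f j) x := by
  have : HasFDerivAt (fun y => ∑ j ∈ s, c j * f j y) (∑ j ∈ s, c j • fderiv ℝ (f j) x) x :=
    HasFDerivAt.fun_sum fun j _ => ((hf j x).hasFDerivAt.const_mul (c j))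
  rw [pd, this.fderiv]
  simp [pd]

/-! ### The maximum principle -/

/-- At a local maximum the second derivative in every direction is nonpositive. -/
theorem sum_pd_pd_nonpos_of_isLocalMax {g : E d → ℝ} (hg : ContDiff ℝ ∞ g) {x : E d}
    (hx : IsLocalMax g x) (v : E d) : ∑ i, ∑ j, v i * v j * pd i (pd j g) x ≤ 0 := by
  by_contra! hpos
  have hline : ∀ t : ℝ, HasDerivAt (fun t : ℝ => x + t • v) v t := fun t => by
    simpa using ((hasDerivAt_id t).smul_const v).const_add x
  have h1 : ∀ {f : E d → ℝ}, Differentiable ℝ f → ∀ t : ℝ,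
      HasDerivAt (fun t : ℝ => f (x + t • v)) (∑ i, v i * pd i f (x + t • v)) t := by
    intro f hf t
    rw [← fderiv_eq_sum_pd]
    exact (hf _).hasFDerivAt.comp_hasDerivAt t (hline t)
  have hd1 : deriv (fun t : ℝ => g (x + t • v)) =
      fun t => ∑ j, v j * pd j g (x + t • v) :=
    funext fun t => (h1 (differentiable_of_contDiff hg) t).deriv
  have hsm : ContDiff ℝ ∞ (fun y => ∑ j, v j * pd j g y) :=
    ContDiff.sum fun j _ => contDiff_const.mul (contDiff_pd hg j)
  have hd2 : deriv (deriv (fun t : ℝ => g (x + t • v))) 0 =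
      ∑ i, ∑ j, v i * v j * pd i (pd j g) x := by
    rw [hd1, (h1 (differentiable_of_contDiff hsm) 0).deriv]
    refine Finset.sum_congr rfl fun i _ => ?_
    rw [pd_sum_const_mul _ _ fun j => differentiable_of_contDiff (contDiff_pd hg j)]
    rw [Finset.mul_sum, zero_smul, add_zero]
    exact Finset.sum_congr rfl fun j _ => by ring
  have hcont : ContinuousAt (fun t : ℝ => x + t • v) 0 := (hline 0).continuousAt
  have hmax : IsLocalMax (fun t : ℝ => g (x + t • v)) 0 := by
    have : Tendsto (fun t : ℝ => x + t • v) (𝓝 0) (𝓝 x) := by simpa using hcont.tendsto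
    simpa [IsLocalMax, IsMaxFilter] using this.eventually hx
  -- A positive second derivative makes the point a local minimum as well, so that the function is
  -- locally constant along the line, and its second derivative vanishes.
  have hmin : IsLocalMin (fun t : ℝ => g (x + t • v)) 0 :=
    isLocalMin_of_deriv_deriv_pos (hd2 ▸ hpos) hmax.deriv_eq_zero
      (h1 (differentiable_of_contDiff hg) 0).continuousAt
  have hconst : (fun t : ℝ => g (x + t • v)) =ᶠ[𝓝 0] fun _ => g (x + (0 : ℝ) • v) := by
    filter_upwards [hmax, hmin] with t h2 h3 using le_antisymm h2 h3
  have : deriv (deriv (fun t : ℝ => g (x + t • v))) 0 = 0 := by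
    rw [hconst.deriv.deriv_eq]
    simp
  rw [hd2] at this
  exact hpos.ne' this

/-- The trace of the product of a positive semidefinite matrix with the Hessian at a local maximum
is nonpositive. -/
theorem sum_mul_pd_pd_nonpos {A : Matrix (Fin d) (Fin d) ℝ} (hA : A.PosSemidef) {g : E d → ℝ}
    (hg : ContDiff ℝ ∞ g) {x : E d} (hx : IsLocalMax g x) :
    ∑ i, ∑ j, A i j * pd i (pd j g) x ≤ 0 := by
  obtain ⟨m, v, rfl⟩ := Matrix.posSemidef_iff_eq_sum_vecMulVec.1 hA
  have h : ∑ i, ∑ j, (∑ k, Matrix.vecMulVec (v k) (star (v k))) i j * pd i (pd j g) x =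
      ∑ k, ∑ i, ∑ j, v k i * v k j * pd i (pd j g) x := by
    simp only [Matrix.sum_apply, Matrix.vecMulVec_apply, star_trivial, Finset.sum_mul]
    rw [Finset.sum_comm (s := Finset.univ (α := Fin m))]
    exact Finset.sum_congr rfl fun i _ => Finset.sum_comm
  rw [h]
  exact Finset.sum_nonpos fun k _ => sum_pd_pd_nonpos_of_isLocalMax hg hx (WithLp.toLp 2 (v k))

theorem pd_norm_sq (i : Fin d) (x : E d) : pd i (fun y => ‖y‖ ^ 2) x = 2 * x i := by
  rw [pd, fderiv_norm_sq_apply]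
  simp [EuclideanSpace.inner_single_right]

/-- The maximum principle for `∑ A_ij ∂_i ∂_j` on the whole space. -/
theorem nonpos_of_tendsto_cocompact {A : Matrix (Fin d) (Fin d) ℝ} (hA : A.PosSemidef)
    (htr : 0 < A.trace) {h : E d → ℝ} (hh : ContDiff ℝ ∞ h)
    (heq : ∀ x, ∑ i, ∑ j, A i j * pd i (pd j h) x = 0)
    (hlim : Tendsto h (cocompact (E d)) (𝓝 0)) (x₀ : E d) : h x₀ ≤ 0 := by
  by_contra! hx₀
  have hev := hlim.eventually (gt_mem_nhds (half_pos hx₀))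
  rw [← Metric.cobounded_eq_cocompact] at hev
  obtain ⟨R₀, -, hR₀⟩ := (Metric.hasBasis_cobounded_compl_closedBall (0 : E d)).mem_iff.1 hev
  set R := max (max R₀ ‖x₀‖) 0 + 1 with hR
  have hR1 : 0 < R := by positivity
  have hR2 : ‖x₀‖ < R := by
    have := le_max_left (max R₀ ‖x₀‖) 0
    have := le_max_right R₀ ‖x₀‖
    linarith
  have hR3 : R₀ < R := by
    have := le_max_left (max R₀ ‖x₀‖) 0
    have := le_max_left R₀ ‖x₀‖
    linarith
  -- A strictly convex perturbation, small enough not to move the maximum to the boundary.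
  set δ := h x₀ / (2 * R ^ 2) with hδ
  have hδ0 : 0 < δ := by positivity
  set g : E d → ℝ := fun y => h y + δ * ‖y‖ ^ 2 with hgdef
  have hg : ContDiff ℝ ∞ g := hh.add (contDiff_const.mul (contDiff_norm_sq ℝ))
  obtain ⟨x₁, hx₁, hmax⟩ := (isCompact_closedBall (0 : E d) R).exists_isMaxOn
    ⟨x₀, by simpa using hR2.le⟩ hg.continuous.continuousOn
  have hge : h x₀ ≤ g x₁ := by
    refine le_trans ?_ (hmax (by simpa using hR2.le : x₀ ∈ Metric.closedBall (0 : E d) R))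
    have : 0 ≤ δ * ‖x₀‖ ^ 2 := by positivity
    simp only [hgdef]; linarith
  have hint : ‖x₁‖ < R := by
    refine lt_of_le_of_ne (by simpa using hx₁) fun hne => ?_
    have h1 : h x₁ < h x₀ / 2 := hR₀ (by simp [hne, hR3])
    have h2 : g x₁ < h x₀ := by
      simp only [hgdef, hne]
      have : δ * R ^ 2 = h x₀ / 2 := by rw [hδ]; field_simp
      linarith
    linarith
  have hloc : IsLocalMax g x₁ :=
    hmax.isLocalMax (Filter.mem_of_superset (Metric.isOpen_ball.mem_nhds (by simpa using hint))
      Metric.ball_subset_closedBall)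
  have h1 := sum_mul_pd_pd_nonpos hA hg hloc
  have hsq : Differentiable ℝ fun y : E d => ‖y‖ ^ 2 :=
    differentiable_of_contDiff (contDiff_norm_sq ℝ)
  have h2 : ∀ j, pd j g = fun y => pd j h y + δ * (2 * y j) := by
    intro j
    ext y
    rw [pd, fderiv_fun_add (differentiable_of_contDiff hh y) ((hsq y).const_mul δ),
      fderiv_const_mul (hsq y), ← pd_norm_sq]
    simp [pd]
  have h3 : ∀ i j, pd i (pd j g) x₁ = pd i (pd j h) x₁ + 2 * δ * (1 : Matrix _ _ ℝ) i j := by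
    intro i j
    have hc : HasFDerivAt (fun y : E d => δ * (2 * y j))
        (δ • (2 : ℝ) • (EuclideanSpace.proj j : E d →L[ℝ] ℝ)) x₁ :=
      ((EuclideanSpace.proj j : E d →L[ℝ] ℝ).hasFDerivAt.const_mul 2).const_mul δ
    rw [h2, pd, fderiv_fun_add (differentiable_of_contDiff (contDiff_pd hh j) x₁)
      hc.differentiableAt, hc.fderiv]
    by_cases hij : i = j
    · subst hij; simp [pd]; ring
    · simp [pd, hij, Ne.symm hij]
  simp only [h3, mul_add, Finset.sum_add_distrib, heq] at h1
  have h4 : ∑ i, ∑ j, A i j * (2 * δ * (1 : Matrix _ _ ℝ) i j) = 2 * δ * A.trace := by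
    simp [Matrix.one_apply, Matrix.trace, mul_comm, Finset.sum_mul]
  rw [h4] at h1
  have : 0 < 2 * δ * A.trace := by positivity
  linarith

theorem eq_zero_of_tendsto_cocompact {A : Matrix (Fin d) (Fin d) ℝ} (hA : A.PosSemidef)
    (htr : 0 < A.trace) {h : E d → ℝ} (hh : ContDiff ℝ ∞ h)
    (heq : ∀ x, ∑ i, ∑ j, A i j * pd i (pd j h) x = 0)
    (hlim : Tendsto h (cocompact (E d)) (𝓝 0)) (x : E d) : h x = 0 := by
  refine le_antisymm (nonpos_of_tendsto_cocompact hA htr hh heq hlim x) ?_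
  have hpd : ∀ (f : E d → ℝ) i, pd i (fun y => -f y) = fun y => -pd i f y := by
    intro f i; ext y; simp [pd]
  have := nonpos_of_tendsto_cocompact hA htr (h := fun y => -h y) hh.neg
    (fun x => by simp [hpd, heq]) (by simpa using hlim.neg) x
  linarith

end Calculus

/-! ### Mollification and the Liouville theorem -/

theorem abs_integral_inner_le {X F : Type*} [MeasurableSpace X] {μ : Measure X}
    [NormedAddCommGroup F] [InnerProductSpace ℝ F] {f g : X → F}
    (hf : MemLp f 2 μ) (hg : MemLp g 2 μ) :
    |∫ y, inner ℝ (f y) (g y) ∂μ| ≤ (eLpNorm f 2 μ).toReal * (eLpNorm g 2 μ).toReal := by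
  have h : ∫ y, inner ℝ (f y) (g y) ∂μ = inner ℝ (hf.toLp f) (hg.toLp g) := by
    rw [L2.inner_def]
    refine integral_congr_ae ?_
    filter_upwards [hf.coeFn_toLp, hg.coeFn_toLp] with y h1 h2
    rw [h1, h2]
  rw [h, ← Lp.norm_toLp f hf, ← Lp.norm_toLp g hg]
  exact abs_real_inner_le_norm _ _

section Mollify

variable {d : ℕ}

theorem memLp_coord {μ : Measure (E d)} {w : E d → E d} (hw : MemLp w 2 μ) (i : Fin d) :
    MemLp (fun y => w y i) 2 μ :=
  (EuclideanSpace.proj i : E d →L[ℝ] ℝ).comp_memLp' hw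

theorem IsTest.memLp {ψ : E d → ℝ} (h : IsTest ψ) : MemLp ψ 2 volume :=
  h.1.continuous.memLp_of_hasCompactSupport h.2

theorem integrable_mul_of_memLp {f g : E d → ℝ} (hf : MemLp f 2 volume) (hg : MemLp g 2 volume) :
    Integrable (fun y => f y * g y) := hf.integrable_mul hg

/-- The convolution `f * ρ`, used with test functions `ρ`. -/
noncomputable def moll (f ρ : E d → ℝ) (x : E d) : ℝ := ∫ t, f t * ρ (x - t)

theorem IsTest.comp_sub_left {ρ : E d → ℝ} (h : IsTest ρ) (x : E d) :
    IsTest fun t => ρ (x - t) :=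
  ⟨h.1.comp (contDiff_const.sub contDiff_id), h.2.comp_homeomorph (Homeomorph.subLeft x)⟩

theorem pd_comp_sub_left {ρ : E d → ℝ} (h : IsTest ρ) (x : E d) (i : Fin d) (t : E d) :
    pd i (fun t => ρ (x - t)) t = -pd i ρ (x - t) := by
  have h1 : HasFDerivAt (fun t => ρ (x - t))
      ((fderiv ℝ ρ (x - t)).comp (-ContinuousLinearMap.id ℝ (E d))) t :=
    (differentiable_of_contDiff h.1 (x - t)).hasFDerivAt.comp t
      ((hasFDerivAt_id t).const_sub x)
  rw [pd, h1.fderiv]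
  simp [pd]

theorem contDiff_moll {f ρ : E d → ℝ} (hf : LocallyIntegrable f) (h : IsTest ρ) :
    ContDiff ℝ ∞ (moll f ρ) :=
  h.2.contDiff_convolution_right (ContinuousLinearMap.mul ℝ ℝ) hf h.1

theorem pd_moll {f ρ : E d → ℝ} (hf : LocallyIntegrable f) (h : IsTest ρ) (i : Fin d) :
    pd i (moll f ρ) = moll f (pd i ρ) := by
  ext x
  have h1 := h.2.hasFDerivAt_convolution_right (ContinuousLinearMap.mul ℝ ℝ) hf
    (h.1.of_le (by simp)) x
  have h2 : fderiv ℝ (moll f ρ) x = _ := h1.fderiv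
  rw [pd, h2, convolution_precompR_apply _ hf (h.2.fderiv (𝕜 := ℝ))
    (h.1.continuous_fderiv (by simp))]
  rfl

/-- There are mollifiers along which every locally integrable function is recovered a.e. -/
theorem exists_mollifier (d : ℕ) : ∃ ρ : ℕ → E d → ℝ, (∀ n, IsTest (ρ n)) ∧
    ∀ f : E d → ℝ, LocallyIntegrable f →
      ∀ᵐ x, Tendsto (fun n => moll f (ρ n) x) atTop (𝓝 (f x)) := by
  let φ : ℕ → ContDiffBump (0 : E d) := fun n =>
    ⟨1 / ((n : ℝ) + 1), 2 * (1 / ((n : ℝ) + 1)), by positivity, by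
      have : 0 < 1 / ((n : ℝ) + 1) := by positivity
      linarith⟩
  refine ⟨fun n => (φ n).normed volume, fun n =>
    ⟨(φ n).contDiff_normed, (φ n).hasCompactSupport_normed⟩, fun f hf => ?_⟩
  have h1 : Tendsto (fun n => (φ n).rOut) atTop (𝓝 0) := by
    have := (tendsto_one_div_add_atTop_nhds_zero_nat (𝕜 := ℝ)).const_mul (2 : ℝ)
    rwa [mul_zero] at this
  filter_upwards [ContDiffBump.ae_convolution_tendsto_right_of_locallyIntegrable (K := 2) h1
    (Eventually.of_forall fun n => le_rfl) hf] with x hx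
  refine hx.congr fun n => ?_
  rw [convolution_lsmul_swap]
  exact integral_congr_ae (Eventually.of_forall fun t => mul_comm _ _)

/-- The mollification of an `L²` function tends to zero at infinity: it has compact support when the
function has, and it depends continuously, in the supremum norm, on the function in `L²`. -/
theorem tendsto_moll_cocompact {f ρ : E d → ℝ} (hf : MemLp f 2 volume) (h : IsTest ρ) :
    Tendsto (moll f ρ) (cocompact (E d)) (𝓝 0) := by
  have hcs : ∀ r : E d → ℝ, MemLp r 2 volume → ∀ x, |moll r ρ x| ≤
      (eLpNorm r 2 volume).toReal * (eLpNorm ρ 2 volume).toReal := by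
    intro r hr x
    have h1 := abs_integral_inner_le hr (h.comp_sub_left x).memLp
    have h2 : eLpNorm (fun t => ρ (x - t)) 2 volume = eLpNorm ρ 2 volume :=
      eLpNorm_comp_measurePreserving h.memLp.1 (Measure.measurePreserving_sub_left volume x)
    rw [h2] at h1
    refine le_trans (le_of_eq ?_) h1
    exact congrArg _ (integral_congr_ae (Eventually.of_forall fun t => mul_comm _ _))
  rw [Metric.tendsto_nhds]
  intro ε hε
  set C := (eLpNorm ρ 2 volume).toReal with hC
  have hC0 : 0 ≤ C := ENNReal.toReal_nonneg
  have hδ : 0 < ε / (C + 1) := by positivity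
  obtain ⟨g, hg1, hg2, hg3, hg4⟩ := hf.exists_hasCompactSupport_eLpNorm_sub_le (by simp)
    (ε := ENNReal.ofReal (ε / (C + 1))) (by simpa using hδ)
  have hcomp : HasCompactSupport (moll g ρ) :=
    hg1.convolution (ContinuousLinearMap.mul ℝ ℝ) h.2
  filter_upwards [hcomp.isCompact.compl_mem_cocompact] with x hx
  have h0 : moll g ρ x = 0 := image_eq_zero_of_notMem_tsupport hx
  have h1 : moll f ρ x = moll (f - g) ρ x := by
    rw [← sub_zero (moll f ρ x), ← h0, moll, moll, moll, ← integral_sub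
      (integrable_mul_of_memLp hf (h.comp_sub_left x).memLp)
      (integrable_mul_of_memLp hg4 (h.comp_sub_left x).memLp)]
    exact integral_congr_ae (Eventually.of_forall fun t => by simp [sub_mul])
  rw [dist_zero_right, Real.norm_eq_abs, h1]
  refine (hcs _ (hf.sub hg4) x).trans_lt ?_
  have h2 : (eLpNorm (f - g) 2 volume).toReal ≤ ε / (C + 1) := by
    refine ENNReal.toReal_le_of_le_ofReal hδ.le hg2
  calc _ ≤ ε / (C + 1) * C := by gcongr
    _ < ε / (C + 1) * (C + 1) := by gcongr; linarith
    _ = ε := by field_simp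

/-- A function with vanishing weak gradient is constant. -/
theorem ae_eq_const_of_weak_grad_zero {f : E d → ℝ} (hf : LocallyIntegrable f)
    (h : ∀ ψ : E d → ℝ, IsTest ψ → ∀ i, ∫ y, f y * pd i ψ y = 0) :
    ∃ c : ℝ, ∀ᵐ y, f y = c := by
  obtain ⟨ρ, hρ, hlim⟩ := exists_mollifier d
  have hconst : ∀ n x, moll f (ρ n) x = moll f (ρ n) 0 := by
    intro n x
    have hd := differentiable_of_contDiff (contDiff_moll hf (hρ n))
    refine is_const_of_fderiv_eq_zero hd (fun y => ?_) x 0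
    ext v
    rw [fderiv_eq_sum_pd]
    refine Finset.sum_eq_zero fun i _ => ?_
    have h1 := h _ ((hρ n).comp_sub_left y) i
    simp only [pd_comp_sub_left (hρ n), mul_neg, integral_neg, neg_eq_zero] at h1
    rw [pd_moll hf (hρ n), moll, h1, mul_zero]
  have hl := hlim f hf
  obtain ⟨x₀, hx₀⟩ := hl.exists
  refine ⟨f x₀, ?_⟩
  filter_upwards [hl] with x hx
  refine tendsto_nhds_unique hx (hx₀.congr fun n => ?_)
  rw [hconst n x, hconst n x₀]

/-- The Liouville theorem: a square integrable field that is weakly curl free and solves the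
homogeneous equation vanishes. Mollification makes it smooth; then each component is
a solution that tends to zero at infinity, and the maximum principle applies. -/
theorem ae_eq_zero_of_curl_free {A : Matrix (Fin d) (Fin d) ℝ} (hA : A.PosSemidef)
    (htr : 0 < A.trace) {w : E d → E d} (hw : MemLp w 2 volume)
    (hcurl : ∀ ψ : E d → ℝ, IsTest ψ → ∀ i j,
      ∫ y, w y i * pd j ψ y = ∫ y, w y j * pd i ψ y)
    (heq : ∀ ψ : E d → ℝ, IsTest ψ → ∫ y, ∑ i, ∑ j, A i j * w y i * pd j ψ y = 0) :
    w =ᵐ[volume] 0 := by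
  obtain ⟨ρ, hρ, hlim⟩ := exists_mollifier d
  have hloc : ∀ i, LocallyIntegrable fun y => w y i := fun i =>
    (memLp_coord hw i).locallyIntegrable (by norm_num)
  have hzero : ∀ n k x, moll (fun y => w y k) (ρ n) x = 0 := by
    intro n k
    have hsm : ∀ i, ContDiff ℝ ∞ (moll (fun y => w y i) (ρ n)) := fun i =>
      contDiff_moll (hloc i) (hρ n)
    have hc : ∀ i j, pd j (moll (fun y => w y i) (ρ n)) = pd i (moll (fun y => w y j) (ρ n)) := by
      intro i j
      ext x
      have h1 := hcurl _ ((hρ n).comp_sub_left x) i j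
      simp only [pd_comp_sub_left (hρ n), mul_neg, integral_neg, neg_inj] at h1
      rw [pd_moll (hloc i) (hρ n), pd_moll (hloc j) (hρ n)]
      exact h1
    have hdiv : ∀ x, ∑ i, ∑ j, A i j * pd j (moll (fun y => w y i) (ρ n)) x = 0 := by
      intro x
      have h1 := heq _ ((hρ n).comp_sub_left x)
      have hint : ∀ i j, Integrable fun y => A i j * w y i * pd j (fun t => ρ n (x - t)) y := by
        intro i j
        simp only [mul_assoc]
        exact (integrable_mul_of_memLp (memLp_coord hw i)
          (((hρ n).comp_sub_left x).pd j).memLp).const_mul _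
      rw [integral_finsetSum _ fun i _ => integrable_finsetSum _ fun j _ => hint i j] at h1
      simp only [integral_finsetSum _ fun j _ => hint _ j] at h1
      simp only [pd_comp_sub_left (hρ n), mul_neg, integral_neg, mul_assoc,
        integral_const_mul, Finset.sum_neg_distrib, neg_eq_zero] at h1
      simp only [pd_moll (hloc _) (hρ n)]
      exact h1
    refine eq_zero_of_tendsto_cocompact hA htr (hsm k) (fun x => ?_)
      (tendsto_moll_cocompact (memLp_coord hw k) (hρ n))
    have hdf : ∀ i j, Differentiable ℝ (pd j (moll (fun y => w y i) (ρ n))) := fun i j =>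
      differentiable_of_contDiff (contDiff_pd (hsm i) j)
    -- As `∂_i w_k = ∂_k w_i`, the equation for `w_k` is the `k`-th derivative of `div (A w) = 0`.
    calc ∑ i, ∑ j, A i j * pd i (pd j (moll (fun y => w y k) (ρ n))) x
        = ∑ i, ∑ j, A i j * pd k (pd j (moll (fun y => w y i) (ρ n))) x := by
          refine Finset.sum_congr rfl fun i _ => Finset.sum_congr rfl fun j _ => ?_
          rw [pd_comm (hsm k), hc k i, pd_comm (hsm i)]
      _ = pd k (fun y => ∑ i, ∑ j, A i j * pd j (moll (fun y => w y i) (ρ n)) y) x := by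
          have h3 := pd_sum_const_mul (Finset.univ (α := Fin d × Fin d)) (fun p => A p.1 p.2)
            (f := fun p => pd p.2 (moll (fun y => w y p.1) (ρ n))) (fun p => hdf p.1 p.2) k x
          simp only [Fintype.sum_prod_type] at h3
          exact h3.symm
      _ = 0 := by simp only [hdiv]; simp [pd]
  have : ∀ᵐ y, ∀ k, w y k = 0 := by
    rw [ae_all_iff]
    intro k
    filter_upwards [hlim _ (hloc k)] with x hx
    simp only [hzero] at hx
    exact (tendsto_nhds_unique hx tendsto_const_nhds)
  filter_upwards [this] with y hy
  ext k
  simpa using hy k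

end Mollify

/-! ### A weighted Poincaré inequality -/

section Poincare

variable {d : ℕ}

/-- The gradient `∇ψ` as a vector field. -/
noncomputable def gradE (ψ : E d → ℝ) (y : E d) : E d := WithLp.toLp 2 fun i => pd i ψ y

@[simp] theorem gradE_apply (ψ : E d → ℝ) (y : E d) (i : Fin d) : gradE ψ y i = pd i ψ y := rfl

theorem fderiv_eq_inner_gradE (ψ : E d → ℝ) (x v : E d) :
    fderiv ℝ ψ x v = inner ℝ (gradE ψ x) v := by
  rw [fderiv_eq_sum_pd, PiLp.inner_apply]
  simp

theorem IsTest.continuous_gradE {ψ : E d → ℝ} (h : IsTest ψ) : Continuous (gradE ψ) :=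
  (PiLp.continuous_toLp 2 _).comp (continuous_pi fun i => (contDiff_pd h.1 i).continuous)

theorem IsTest.hasCompactSupport_gradE {ψ : E d → ℝ} (h : IsTest ψ) :
    HasCompactSupport (gradE ψ) := by
  refine HasCompactSupport.intro h.2 fun x hx => ?_
  ext i
  have h1 := image_eq_zero_of_notMem_tsupport
    (fun h' => hx (tsupport_fderiv_subset ℝ h') : x ∉ tsupport (fderiv ℝ ψ))
  simp [GradModel.pd, h1]

theorem IsTest.memLp_gradE {ψ : E d → ℝ} (h : IsTest ψ) : MemLp (gradE ψ) 2 volume :=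
  h.continuous_gradE.memLp_of_hasCompactSupport h.hasCompactSupport_gradE

/-- The increment along a segment is controlled by the gradient on it. -/
theorem sq_sub_le_segment {ψ : E d → ℝ} (h : IsTest ψ) (x z : E d) :
    ENNReal.ofReal ((ψ x - ψ z) ^ 2) ≤ ENNReal.ofReal (‖x - z‖ ^ 2) *
      ∫⁻ t in Set.Icc (0 : ℝ) 1, ENNReal.ofReal (‖gradE ψ (z + t • (x - z))‖ ^ 2) := by
  have hline : ∀ t : ℝ, HasDerivAt (fun t : ℝ => z + t • (x - z)) (x - z) t := fun t => by
    simpa using ((hasDerivAt_id t).smul_const (x - z)).const_add z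
  have hlc : Continuous fun t : ℝ => z + t • (x - z) := by fun_prop
  set a : ℝ → ℝ := fun t => inner ℝ (gradE ψ (z + t • (x - z))) (x - z) with ha
  have hac : Continuous a := (h.continuous_gradE.comp hlc).inner continuous_const
  have h1 : ∫ t in Set.Icc (0 : ℝ) 1, a t = ψ x - ψ z := by
    rw [integral_Icc_eq_integral_Ioc, ← intervalIntegral.integral_of_le zero_le_one,
      intervalIntegral.integral_eq_sub_of_hasDerivAt (f := fun t => ψ (z + t • (x - z)))]
    · simp
    · intro t _
      have h0 := (differentiable_of_contDiff h.1 _).hasFDerivAt.comp_hasDerivAt t (hline t)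
      rw [fderiv_eq_inner_gradE] at h0
      exact h0
    · exact hac.intervalIntegrable _ _
  have hi : ∀ {f : ℝ → ℝ}, Continuous f → IntegrableOn f (Set.Icc (0 : ℝ) 1) := fun hf =>
    hf.continuousOn.integrableOn_compact isCompact_Icc
  -- Jensen's inequality on the unit interval, from `0 ≤ ∫ (a - ∫ a)²`.
  have h2 : (ψ x - ψ z) ^ 2 ≤ ∫ t in Set.Icc (0 : ℝ) 1, a t ^ 2 := by
    set m := ψ x - ψ z
    have h3 : 0 ≤ ∫ t in Set.Icc (0 : ℝ) 1, (a t - m) ^ 2 :=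
      integral_nonneg fun t => sq_nonneg _
    have h4 : ∀ t, (a t - m) ^ 2 = a t ^ 2 - 2 * m * a t + m ^ 2 := fun t => by ring
    simp only [h4] at h3
    rw [integral_add (f := fun t => a t ^ 2 - 2 * m * a t) (g := fun _ => m ^ 2)
      (hi (by fun_prop)) (hi continuous_const),
      integral_sub (f := fun t => a t ^ 2) (g := fun t => 2 * m * a t)
      (hi (by fun_prop)) (hi (by fun_prop)), integral_const_mul, h1] at h3
    simp at h3
    nlinarith
  have h5 : ∫ t in Set.Icc (0 : ℝ) 1, a t ^ 2 ≤
      ‖x - z‖ ^ 2 * ∫ t in Set.Icc (0 : ℝ) 1, ‖gradE ψ (z + t • (x - z))‖ ^ 2 := by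
    rw [← integral_const_mul]
    have hgc : Continuous fun t : ℝ => ‖gradE ψ (z + t • (x - z))‖ ^ 2 :=
      (h.continuous_gradE.comp hlc).norm.pow 2
    refine integral_mono (hi (hac.pow 2)) (hi (continuous_const.mul hgc)) fun t => ?_
    have := abs_real_inner_le_norm (gradE ψ (z + t • (x - z))) (x - z)
    calc a t ^ 2 = |a t| ^ 2 := (sq_abs _).symm
      _ ≤ (‖gradE ψ (z + t • (x - z))‖ * ‖x - z‖) ^ 2 := by gcongr
      _ = _ := by ring
  rw [← ofReal_integral_eq_lintegral_ofReal
    (f := fun t => ‖gradE ψ (z + t • (x - z))‖ ^ 2) (hi ((h.continuous_gradE.comp hlc).norm.pow 2))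
    (Eventually.of_forall fun t => sq_nonneg _), ← ENNReal.ofReal_mul (sq_nonneg _)]
  exact ENNReal.ofReal_le_ofReal (h2.trans h5)

theorem lintegral_comp_add_smul_le {G : E d → ENNReal} (hG : Measurable G) (c : E d) {s : ℝ}
    (hs : 1 / 2 ≤ s) : ∫⁻ x, G (c + s • x) ≤ 2 ^ d * ∫⁻ x, G x := by
  have hs0 : 0 < s := by linarith
  have h1 : ∫⁻ x, G (c + s • x) = ENNReal.ofReal |(s ^ d)⁻¹| * ∫⁻ x, G x := by
    rw [← lintegral_add_left_eq_self G c]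
    have h2 := Measure.map_addHaar_smul (volume : Measure (E d)) hs0.ne'
    rw [← lintegral_map (f := fun y => G (c + y)) (g := fun x => s • x)
      (hG.comp (measurable_const_add c)) (measurable_const_smul s), h2, lintegral_smul_measure]
    simp
  rw [h1]
  gcongr
  rw [abs_of_pos (by positivity), ← inv_pow, ENNReal.ofReal_pow (by positivity)]
  gcongr
  rw [← ENNReal.ofReal_ofNat 2]
  refine ENNReal.ofReal_le_ofReal ?_
  rw [inv_le_comm₀ hs0 two_pos]
  linarith

/-- The weight `(1 + |x|)^{-(d+3)}`; it stays integrable after multiplication by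
`(1 + |x|)^2`, which absorbs the length of the segments in the Poincaré inequality. -/
noncomputable def wt (x : E d) : ℝ := (1 + ‖x‖) ^ (-((d : ℝ) + 3))

/-- The weight `(1 + |x|)^{-(d+1)}`; it is integrable. -/
noncomputable def wt' (x : E d) : ℝ := (1 + ‖x‖) ^ (-((d : ℝ) + 1))

theorem wt_pos (x : E d) : 0 < wt x := by unfold wt; positivity

theorem wt'_pos (x : E d) : 0 < wt' x := by unfold wt'; positivity

theorem wt'_le_one (x : E d) : wt' x ≤ 1 :=
  Real.rpow_le_one_of_one_le_of_nonpos (by linarith [norm_nonneg x])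
    (by have : (0 : ℝ) ≤ d := Nat.cast_nonneg d; linarith)

theorem sq_mul_wt (x : E d) : (1 + ‖x‖) ^ 2 * wt x = wt' x := by
  unfold wt wt'
  rw [← Real.rpow_natCast, ← Real.rpow_add (by positivity)]
  congr 1
  push_cast
  ring

theorem wt_le_wt' (x : E d) : wt x ≤ wt' x := by
  rw [← sq_mul_wt]
  have := wt_pos x
  nlinarith [norm_nonneg x, mul_nonneg (norm_nonneg x) this.le, sq_nonneg ‖x‖,
    mul_nonneg (sq_nonneg ‖x‖) this.le]

theorem continuous_wt : Continuous (wt (d := d)) := by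
  refine Continuous.rpow_const (by fun_prop) fun x => Or.inl ?_
  positivity

theorem continuous_wt' : Continuous (wt' (d := d)) := by
  refine Continuous.rpow_const (by fun_prop) fun x => Or.inl ?_
  positivity

theorem integrable_wt' : Integrable (wt' (d := d)) :=
  integrable_one_add_norm (by simp)

theorem sq_norm_sub_mul_wt_le (x z : E d) : ‖x - z‖ ^ 2 * (wt x * wt z) ≤ wt' x * wt' z := by
  rw [← sq_mul_wt, ← sq_mul_wt]
  have h1 : ‖x - z‖ ≤ (1 + ‖x‖) * (1 + ‖z‖) := by
    refine (norm_sub_le x z).trans ?_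
    nlinarith [norm_nonneg x, norm_nonneg z, mul_nonneg (norm_nonneg x) (norm_nonneg z)]
  have := wt_pos x
  have := wt_pos z
  calc ‖x - z‖ ^ 2 * (wt x * wt z) ≤ ((1 + ‖x‖) * (1 + ‖z‖)) ^ 2 * (wt x * wt z) := by gcongr
    _ = _ := by ring

/-- The finite measure with density `wt`. -/
noncomputable def wtMeasure (d : ℕ) : Measure (E d) :=
  volume.withDensity fun x => ENNReal.ofReal (wt x)

instance : IsFiniteMeasure (wtMeasure d) :=
  isFiniteMeasure_withDensity_ofReal <| Integrable.hasFiniteIntegral <|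
    integrable_wt'.mono' continuous_wt.aestronglyMeasurable <| Eventually.of_forall fun x => by
      rw [Real.norm_of_nonneg (wt_pos x).le]; exact wt_le_wt' x

theorem lintegral_wtMeasure {f : E d → ENNReal} (hf : Measurable f) :
    ∫⁻ x, f x ∂(wtMeasure d) = ∫⁻ x, ENNReal.ofReal (wt x) * f x :=
  lintegral_withDensity_eq_lintegral_mul _ continuous_wt.measurable.ennreal_ofReal hf

theorem lintegral_mul_comp_add_smul_le {G H : E d → ENNReal} (hG : Measurable G)
    (hH : Measurable H) {c : E d → E d} {s : ℝ} (hs : 1 / 2 ≤ s) :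
    ∫⁻ x, ∫⁻ z, H x * G (c x + s • z) ≤ (2 ^ d * ∫⁻ x, H x) * ∫⁻ y, G y := by
  calc ∫⁻ x, ∫⁻ z, H x * G (c x + s • z) ≤ ∫⁻ x, H x * (2 ^ d * ∫⁻ y, G y) := by
        refine lintegral_mono fun x => ?_
        have hmx : Measurable fun z => G (c x + s • z) :=
          hG.comp ((measurable_const_smul s).const_add (c x))
        rw [lintegral_const_mul _ hmx]
        gcongr
        exact lintegral_comp_add_smul_le hG (c x) hs
    _ = _ := by rw [lintegral_mul_const _ hH]; ring

/-- For a fixed point on the segment `z + t (x - z)`, the change of variables is made in `x` when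
`t ≥ 1/2` and in `z` otherwise. -/
theorem lintegral_segment_le {G H : E d → ENNReal} (hG : Measurable G)
    (hH : Measurable H) (hH1 : ∀ x, H x ≤ 1) (t : ℝ) :
    ∫⁻ x, ∫⁻ z, H x * H z * G (z + t • (x - z)) ≤ (2 ^ d * ∫⁻ x, H x) * ∫⁻ y, G y := by
  rcases le_total (1 / 2) t with h2 | h2
  · have hm : Measurable fun p : E d × E d => H p.1 * H p.2 * G (p.2 + t • (p.1 - p.2)) :=
      ((hH.comp measurable_fst).mul (hH.comp measurable_snd)).mul
        (hG.comp (measurable_snd.add ((measurable_fst.sub measurable_snd).const_smul t)))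
    rw [lintegral_lintegral_swap hm.aemeasurable]
    refine le_trans ?_ (lintegral_mul_comp_add_smul_le hG hH (c := fun z => (1 - t) • z) h2)
    refine lintegral_mono fun z => lintegral_mono fun x => ?_
    have : z + t • (x - z) = (1 - t) • z + t • x := by module
    dsimp only
    rw [this]
    gcongr
    exact mul_le_of_le_one_left' (hH1 x)
  · refine le_trans ?_ (lintegral_mul_comp_add_smul_le hG hH (c := fun x => t • x)
      (s := 1 - t) (by linarith))
    refine lintegral_mono fun x => lintegral_mono fun z => ?_
    have : z + t • (x - z) = t • x + (1 - t) • z := by module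
    dsimp only
    rw [this]
    gcongr
    exact mul_le_of_le_one_right' (hH1 z)

/-- The double integral of the squared increments is controlled by the gradient. -/
theorem lintegral_sq_sub_le {ψ : E d → ℝ} (h : IsTest ψ) :
    ∫⁻ x, ∫⁻ z, ENNReal.ofReal ((ψ x - ψ z) ^ 2) ∂(wtMeasure d) ∂(wtMeasure d) ≤
      (2 ^ d * ∫⁻ x, ENNReal.ofReal (wt' (d := d) x)) *
        ∫⁻ y, ENNReal.ofReal (‖gradE ψ y‖ ^ 2) := by
  obtain ⟨G, hGdef⟩ : ∃ G : E d → ENNReal, G = fun y => ENNReal.ofReal (‖gradE ψ y‖ ^ 2) :=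
    ⟨_, rfl⟩
  have hGm : Measurable G := hGdef ▸ (h.continuous_gradE.norm.pow 2).measurable.ennreal_ofReal
  obtain ⟨H, hHdef⟩ : ∃ H : E d → ENNReal, H = fun x => ENNReal.ofReal (wt' x) := ⟨_, rfl⟩
  have hHm : Measurable H := hHdef ▸ continuous_wt'.measurable.ennreal_ofReal
  have hH1 : ∀ x, H x ≤ 1 := fun x => by
    rw [hHdef, ← ENNReal.ofReal_one]; exact ENNReal.ofReal_le_ofReal (wt'_le_one x)
  have hGtm : Measurable fun p : E d × E d × ℝ => G (p.2.1 + p.2.2 • (p.1 - p.2.1)) :=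
    hGm.comp (Continuous.measurable (by fun_prop))
  have hψ : Continuous ψ := h.1.continuous
  have hsm : Measurable fun p : E d × E d => ENNReal.ofReal ((ψ p.1 - ψ p.2) ^ 2) := by
    refine Measurable.ennreal_ofReal (Continuous.measurable ?_)
    fun_prop
  have hm3 : Measurable fun p : E d × E d × ℝ =>
      H p.1 * H p.2.1 * G (p.2.1 + p.2.2 • (p.1 - p.2.1)) :=
    ((hHm.comp measurable_fst).mul (hHm.comp (measurable_fst.comp measurable_snd))).mul hGtm
  rw [show (fun x : E d => ENNReal.ofReal (wt' x)) = H from hHdef.symm,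
    show (fun y => ENNReal.ofReal (‖gradE ψ y‖ ^ 2)) = G from hGdef.symm]
  calc ∫⁻ x, ∫⁻ z, ENNReal.ofReal ((ψ x - ψ z) ^ 2) ∂(wtMeasure d) ∂(wtMeasure d)
      = ∫⁻ x, ∫⁻ z, ENNReal.ofReal (wt x) *
          (ENNReal.ofReal (wt z) * ENNReal.ofReal ((ψ x - ψ z) ^ 2)) := by
        rw [lintegral_wtMeasure hsm.lintegral_prod_right']
        refine lintegral_congr fun x => ?_
        have hx : Measurable fun z => ENNReal.ofReal ((ψ x - ψ z) ^ 2) :=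
          hsm.comp (measurable_const.prodMk measurable_id)
        rw [lintegral_wtMeasure hx, lintegral_const_mul]
        exact continuous_wt.measurable.ennreal_ofReal.mul hx
    _ ≤ ∫⁻ x, ∫⁻ z, ∫⁻ t in Set.Icc (0 : ℝ) 1, H x * H z * G (z + t • (x - z)) := by
        refine lintegral_mono fun x => lintegral_mono fun z => ?_
        have hmt : Measurable fun t : ℝ => G (z + t • (x - z)) :=
          hGtm.comp (measurable_const.prodMk (measurable_const.prodMk measurable_id))
        rw [lintegral_const_mul _ hmt]
        have h1 := sq_sub_le_segment h x z
        rw [show (fun t : ℝ => ENNReal.ofReal (‖gradE ψ (z + t • (x - z))‖ ^ 2)) =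
          fun t => G (z + t • (x - z)) by rw [hGdef]] at h1
        calc ENNReal.ofReal (wt x) * (ENNReal.ofReal (wt z) * ENNReal.ofReal ((ψ x - ψ z) ^ 2))
            ≤ ENNReal.ofReal (wt x) * (ENNReal.ofReal (wt z) * (ENNReal.ofReal (‖x - z‖ ^ 2) *
              ∫⁻ t in Set.Icc (0 : ℝ) 1, G (z + t • (x - z)))) := by gcongr
          _ = ENNReal.ofReal (‖x - z‖ ^ 2 * (wt x * wt z)) *
              ∫⁻ t in Set.Icc (0 : ℝ) 1, G (z + t • (x - z)) := by
              rw [ENNReal.ofReal_mul (sq_nonneg _), ENNReal.ofReal_mul (wt_pos x).le]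
              ring
          _ ≤ _ := by
              gcongr
              rw [hHdef, ← ENNReal.ofReal_mul (wt'_pos x).le]
              exact ENNReal.ofReal_le_ofReal (sq_norm_sub_mul_wt_le x z)
    _ = ∫⁻ t in Set.Icc (0 : ℝ) 1, ∫⁻ x, ∫⁻ z, H x * H z * G (z + t • (x - z)) := by
        have hm3' : Measurable fun p : (E d × ℝ) × E d =>
            H p.1.1 * H p.2 * G (p.2 + p.1.2 • (p.1.1 - p.2)) :=
          hm3.comp ((measurable_fst.comp measurable_fst).prodMk
            (measurable_snd.prodMk (measurable_snd.comp measurable_fst)))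
        rw [← lintegral_lintegral_swap
          (f := fun x t => ∫⁻ z, H x * H z * G (z + t • (x - z)))
          (hm3'.lintegral_prod_right'.aemeasurable)]
        refine lintegral_congr fun x => ?_
        exact lintegral_lintegral_swap (f := fun z t => H x * H z * G (z + t • (x - z)))
          (hm3.comp (measurable_const.prodMk measurable_id)).aemeasurable
    _ ≤ ∫⁻ t in Set.Icc (0 : ℝ) 1, (2 ^ d * ∫⁻ x, H x) * ∫⁻ y, G y :=
        lintegral_mono fun t => lintegral_segment_le hGm hHm hH1 t
    _ = _ := by simp

end Poincare

theorem eLpNorm_two_sq {X F : Type*} [MeasurableSpace X] {μ : Measure X} [NormedAddCommGroup F]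
    (f : X → F) : eLpNorm f 2 μ ^ 2 = ∫⁻ x, ENNReal.ofReal (‖f x‖ ^ 2) ∂μ := by
  have h := eLpNorm_nnreal_pow_eq_lintegral (f := f) (μ := μ) (p := 2) two_ne_zero
  simp only [NNReal.coe_ofNat, ENNReal.rpow_ofNat, ENNReal.coe_ofNat] at h
  rw [h]
  refine lintegral_congr fun x => ?_
  rw [ENNReal.ofReal_pow (norm_nonneg _), ofReal_norm]

section Existence

variable {d : ℕ}

theorem wtMeasure_univ_ne_zero : wtMeasure d Set.univ ≠ 0 := by
  intro h
  have h1 : ∫⁻ x, 1 ∂(wtMeasure d) = 0 := by simpa using h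
  rw [lintegral_wtMeasure measurable_const, lintegral_eq_zero_iff
    (by simpa using continuous_wt.measurable.ennreal_ofReal)] at h1
  obtain ⟨x, hx⟩ := h1.exists
  simp only [mul_one, Pi.zero_apply, ENNReal.ofReal_eq_zero] at hx
  exact absurd hx (not_le.2 (wt_pos x))

/-- The weighted Poincaré inequality `∫ |ψ - m|² wt ≤ C ∫ |∇ψ|²`, `m` the weighted mean of `ψ`. -/
theorem exists_poincare (d : ℕ) : ∃ C : NNReal, ∀ ψ : E d → ℝ, IsTest ψ →
    eLpNorm (fun x => ψ x - ⨍ z, ψ z ∂(wtMeasure d)) 2 (wtMeasure d) ≤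
      C * eLpNorm (gradE ψ) 2 volume := by
  set ν := wtMeasure d with hν
  have hν0 : ν Set.univ ≠ 0 := wtMeasure_univ_ne_zero
  have : NeZero ν := ⟨fun h => hν0 (by simp [h])⟩
  set K : ENNReal := (ν Set.univ)⁻¹ * (2 ^ d * ∫⁻ x, ENNReal.ofReal (wt' (d := d) x)) with hK
  have hKtop : K ≠ ⊤ := by
    refine ENNReal.mul_ne_top (ENNReal.inv_ne_top.2 hν0) (ENNReal.mul_ne_top (by simp) ?_)
    rw [← ofReal_integral_eq_lintegral_ofReal integrable_wt'
      (Eventually.of_forall fun x => (wt'_pos x).le)]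
    exact ENNReal.ofReal_ne_top
  refine ⟨NNReal.sqrt K.toNNReal, fun ψ h => ?_⟩
  have hint : ∀ {f : E d → ℝ}, Continuous f → (∃ M, ∀ x, |f x| ≤ M) → Integrable f ν := by
    rintro f hf ⟨M, hM⟩
    exact Integrable.of_bound hf.aestronglyMeasurable M (Eventually.of_forall hM)
  obtain ⟨M, hM⟩ := h.2.exists_bound_of_continuous h.1.continuous
  have hψi : Integrable ψ ν := hint h.1.continuous ⟨M, hM⟩
  have hpt : ∀ x, ENNReal.ofReal (‖ψ x - ⨍ z, ψ z ∂ν‖ ^ 2) ≤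
      (ν Set.univ)⁻¹ * ∫⁻ z, ENNReal.ofReal ((ψ x - ψ z) ^ 2) ∂ν := by
    intro x
    have hf : Integrable (fun z => ψ x - ψ z) ν := (integrable_const _).sub hψi
    have hf2 : Integrable (fun z => (ψ x - ψ z) ^ 2) ν := by
      refine hint ((continuous_const.sub h.1.continuous).pow 2) ⟨(M + M) ^ 2, fun z => ?_⟩
      rw [abs_pow]
      gcongr
      exact (abs_sub _ _).trans (add_le_add (hM x) (hM z))
    have h1 : ⨍ z, (ψ x - ψ z) ∂ν = ψ x - ⨍ z, ψ z ∂ν := by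
      rw [average_eq, average_eq, integral_sub (integrable_const _) hψi, smul_sub]
      congr 1
      rw [integral_const, smul_smul, inv_mul_cancel₀, one_smul]
      simpa [Measure.real, ENNReal.toReal_eq_zero_iff] using this.out
    have h2 := (even_two.convexOn_pow (𝕜 := ℝ)).map_average_le
      (continuous_pow 2).continuousOn isClosed_univ (Eventually.of_forall fun _ => Set.mem_univ _)
      hf hf2
    rw [h1] at h2
    rw [Real.norm_eq_abs, sq_abs]
    refine (ENNReal.ofReal_le_ofReal h2).trans ?_
    change ENNReal.ofReal (⨍ z, (ψ x - ψ z) ^ 2 ∂ν) ≤ _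
    rw [average_eq, smul_eq_mul, ENNReal.ofReal_mul (by positivity),
      ofReal_integral_eq_lintegral_ofReal hf2 (Eventually.of_forall fun _ => sq_nonneg _)]
    gcongr
    rw [Measure.real, ← ENNReal.toReal_inv]
    exact ENNReal.ofReal_toReal_le
  have hmain : eLpNorm (fun x => ψ x - ⨍ z, ψ z ∂ν) 2 ν ^ 2 ≤
      K * eLpNorm (gradE ψ) 2 volume ^ 2 := by
    rw [eLpNorm_two_sq, eLpNorm_two_sq, hK, mul_assoc]
    refine (lintegral_mono hpt).trans ?_
    rw [lintegral_const_mul]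
    · gcongr
      exact lintegral_sq_sub_le h
    · have hc := h.1.continuous
      have : Measurable fun p : E d × E d => ENNReal.ofReal ((ψ p.1 - ψ p.2) ^ 2) :=
        Measurable.ennreal_ofReal (Continuous.measurable (by fun_prop))
      exact this.lintegral_prod_right'
  refine (ENNReal.pow_le_pow_left_iff two_ne_zero).1 ?_
  rw [mul_pow, ← ENNReal.coe_pow, NNReal.sq_sqrt, ENNReal.coe_toNNReal hKtop]
  exact hmain

/-! ### Solutions of the equation on the whole space -/

/-- The Lax–Milgram theorem on a closed subspace. -/
theorem exists_lax_milgram {H : Type*} [NormedAddCommGroup H] [InnerProductSpace ℝ H]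
    [CompleteSpace H] (G : Submodule ℝ H) (hG : IsClosed (G : Set H)) (T : H →L[ℝ] H) {c : ℝ}
    (hc : 0 < c) (hT : ∀ v, c * ‖v‖ ^ 2 ≤ inner ℝ v (T v)) (f : H) :
    ∃ v ∈ G, ∀ w ∈ G, inner ℝ v (T w) = inner ℝ f w := by
  have : CompleteSpace G := hG.completeSpace_coe
  let B : G →L[ℝ] G →L[ℝ] ℝ := (innerSL ℝ (E := H)).bilinearComp G.subtypeL (T.comp G.subtypeL)
  have hB : ∀ v w : G, B v w = inner ℝ (v : H) (T w) := fun v w => rfl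
  have hco : IsCoercive B := ⟨c, hc, fun v => by
    rw [hB, mul_assoc, ← sq]; exact hT v⟩
  let f' : G := (InnerProductSpace.toDual ℝ G).symm ((innerSL ℝ f).comp G.subtypeL)
  refine ⟨hco.continuousLinearEquivOfBilin.symm f', Subtype.property _, fun w hw => ?_⟩
  have h1 := hco.continuousLinearEquivOfBilin_apply
    (hco.continuousLinearEquivOfBilin.symm f') ⟨w, hw⟩
  rw [ContinuousLinearEquiv.apply_symm_apply, hB] at h1
  rw [← h1]
  exact InnerProductSpace.toDual_symm_apply

/-- The space of gradients of test functions in `L²`. -/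
noncomputable def testGrad (d : ℕ) : Submodule ℝ (Lp (E d) 2 (volume : Measure (E d))) where
  carrier := {f | ∃ ψ : E d → ℝ, IsTest ψ ∧ f =ᵐ[volume] gradE ψ}
  zero_mem' := by
    refine ⟨fun _ => 0, ⟨contDiff_const, HasCompactSupport.zero⟩, ?_⟩
    filter_upwards [Lp.coeFn_zero (E d) 2 (volume : Measure (E d))] with y hy
    rw [hy]
    ext i
    simp [pd]
  add_mem' := by
    rintro f g ⟨ψ, h, hf⟩ ⟨φ, h', hg⟩
    refine ⟨ψ + φ, ⟨h.1.add h'.1, h.2.add h'.2⟩, ?_⟩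
    filter_upwards [Lp.coeFn_add f g, hf, hg] with y hy h1 h2
    rw [hy, Pi.add_apply, h1, h2]
    ext i
    simp [pd, fderiv_add (differentiable_of_contDiff h.1 y) (differentiable_of_contDiff h'.1 y)]
  smul_mem' := by
    rintro c f ⟨ψ, h, hf⟩
    refine ⟨c • ψ, ⟨contDiff_const.smul h.1, h.2.smul_left (f := fun _ => c)⟩, ?_⟩
    filter_upwards [Lp.coeFn_smul c f, hf] with y hy h1
    rw [hy, Pi.smul_apply, h1]
    ext i
    simp [pd, fderiv_const_smul (differentiable_of_contDiff h.1 y)]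

theorem mem_testGrad {f : Lp (E d) 2 (volume : Measure (E d))} :
    f ∈ testGrad d ↔ ∃ ψ : E d → ℝ, IsTest ψ ∧ f =ᵐ[volume] gradE ψ := Iff.rfl

theorem memLp_restrict_of_wtMeasure {u : E d → ℝ} (hu : MemLp u 2 (wtMeasure d)) {K : Set (E d)}
    (hK : IsCompact K) : MemLp u 2 (volume.restrict K) := by
  rcases K.eq_empty_or_nonempty with rfl | hne
  · simp
  obtain ⟨x₀, -, hmin⟩ := hK.exists_isMinOn hne continuous_wt.continuousOn
  have hpos := wt_pos x₀
  refine hu.of_measure_le_smul (c := ENNReal.ofReal (wt x₀)⁻¹) ENNReal.ofReal_ne_top ?_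
  refine Measure.le_iff.2 fun s hs => ?_
  rw [Measure.restrict_apply hs, Measure.smul_apply, smul_eq_mul, wtMeasure,
    withDensity_apply _ hs]
  calc volume (s ∩ K) = ENNReal.ofReal (wt x₀)⁻¹ * ∫⁻ _ in s ∩ K, ENNReal.ofReal (wt x₀) := by
        rw [setLIntegral_const, ← mul_assoc, ← ENNReal.ofReal_mul (by positivity),
          inv_mul_cancel₀ hpos.ne', ENNReal.ofReal_one, one_mul]
    _ ≤ ENNReal.ofReal (wt x₀)⁻¹ * ∫⁻ x in s ∩ K, ENNReal.ofReal (wt x) := by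
        refine mul_le_mul_right ?_ _
        refine setLIntegral_mono' (hs.inter hK.measurableSet) fun x hx => ?_
        exact ENNReal.ofReal_le_ofReal (hmin hx.2)
    _ ≤ _ := by
        refine mul_le_mul_right ?_ _
        exact lintegral_mono_set Set.inter_subset_left

theorem integral_mul_eq_wtMeasure (u φ : E d → ℝ) :
    ∫ y, u y * φ y = ∫ y, u y * (φ y / wt y) ∂(wtMeasure d) := by
  rw [wtMeasure, integral_withDensity_eq_integral_toReal_smul
    continuous_wt.measurable.ennreal_ofReal (Eventually.of_forall fun _ => ENNReal.ofReal_lt_top)]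
  refine integral_congr_ae (Eventually.of_forall fun y => ?_)
  have := (wt_pos y).ne'
  simp only [ENNReal.toReal_ofReal (wt_pos y).le, smul_eq_mul]
  field_simp

theorem integral_mul_pd_of_isTest {f φ : E d → ℝ} (hf : ContDiff ℝ ∞ f) (hφ : IsTest φ)
    (i : Fin d) : ∫ y, f y * pd i φ y = -∫ y, pd i f y * φ y := by
  have hc : ∀ {g k : E d → ℝ}, Continuous g → Continuous k → HasCompactSupport k →
      Integrable fun y => g y * k y := fun hg hk hs =>
    (hg.mul hk).integrable_of_hasCompactSupport hs.mul_left
  exact integral_mul_fderiv_eq_neg_fderiv_mul_of_integrable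
    (hc (contDiff_pd hf i).continuous hφ.1.continuous hφ.2)
    (hc hf.continuous (contDiff_pd hφ.1 i).continuous (hasCompactSupport_pd hφ.2 i))
    (hc hf.continuous hφ.1.continuous hφ.2)
    (fun y _ => differentiable_of_contDiff hf y) fun y _ => differentiable_of_contDiff hφ.1 y

/-- An `L²` limit of gradients of test functions is the weak gradient of a function in
`L²_loc`, namely of the limit of the test functions with their weighted means subtracted. -/
theorem exists_potential {v : Lp (E d) 2 (volume : Measure (E d))}
    (hv : v ∈ closure (testGrad d : Set (Lp (E d) 2 (volume : Measure (E d))))) :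
    ∃ u : E d → ℝ, (∀ K : Set (E d), IsCompact K → MemLp u 2 (volume.restrict K)) ∧
      ∀ φ : E d → ℝ, IsTest φ → ∀ i, ∫ y, u y * pd i φ y = -∫ y, v y i * φ y := by
  obtain ⟨V, hV, hlim⟩ := mem_closure_iff_seq_limit.1 hv
  choose ψ hψ hVψ' using fun n => mem_testGrad.1 (hV n)
  have hVψ : ∀ n, V n = (hψ n).memLp_gradE.toLp (gradE (ψ n)) := fun n =>
    Lp.ext ((hVψ' n).trans (hψ n).memLp_gradE.coeFn_toLp.symm)
  obtain ⟨C, hC⟩ := exists_poincare d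
  have hmem : ∀ {f : E d → ℝ}, IsTest f → ∀ c : ℝ, MemLp (fun x => f x - c) 2 (wtMeasure d) := by
    intro f hf c
    obtain ⟨M, hM⟩ := hf.2.exists_bound_of_continuous hf.1.continuous
    exact (MemLp.of_bound hf.1.continuous.aestronglyMeasurable M
      (Eventually.of_forall hM)).sub (memLp_const c)
  have hint : ∀ {f : E d → ℝ}, IsTest f → Integrable f (wtMeasure d) := fun hf => by
    simpa using (hmem hf 0).integrable one_le_two
  set m : ℕ → ℝ := fun n => ⨍ z, ψ n z ∂(wtMeasure d) with hm
  set U : ℕ → Lp ℝ 2 (wtMeasure d) := fun n => (hmem (hψ n) (m n)).toLp _ with hU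
  have hdist : ∀ n k, dist (U n) (U k) ≤ C * dist (V n) (V k) := by
    intro n k
    have hs : IsTest (ψ n - ψ k) := ⟨(hψ n).1.sub (hψ k).1, (hψ n).2.sub (hψ k).2⟩
    have h1 := hC _ hs
    rw [dist_eq_norm, dist_eq_norm, hU, hVψ, hVψ, ← MemLp.toLp_sub, ← MemLp.toLp_sub,
      Lp.norm_toLp, Lp.norm_toLp]
    have h2 : (fun x => (ψ n - ψ k) x - ⨍ z, (ψ n - ψ k) z ∂(wtMeasure d)) =
        (fun x => ψ n x - m n) - fun x => ψ k x - m k := by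
      ext x
      have : ⨍ z, (ψ n - ψ k) z ∂(wtMeasure d) = m n - m k := by
        simp only [hm, average_eq, Pi.sub_apply]
        rw [integral_sub (hint (hψ n)) (hint (hψ k)), smul_sub]
      rw [this]
      simp only [Pi.sub_apply]
      ring
    have h3 : gradE (ψ n - ψ k) = gradE (ψ n) - gradE (ψ k) := by
      ext y i
      simp [pd, fderiv_sub (differentiable_of_contDiff (hψ n).1 y)
        (differentiable_of_contDiff (hψ k).1 y)]
    rw [h2, h3] at h1
    have h4 := ENNReal.toReal_mono
      (ENNReal.mul_ne_top ENNReal.coe_ne_top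
        ((hψ n).memLp_gradE.sub (hψ k).memLp_gradE).2.ne) h1
    rwa [ENNReal.toReal_mul, ENNReal.coe_toReal] at h4
  have hcau : CauchySeq U := by
    rw [Metric.cauchySeq_iff']
    intro ε hε
    obtain ⟨N, hN⟩ := Metric.cauchySeq_iff'.1 hlim.cauchySeq (ε / (C + 1)) (by positivity)
    refine ⟨N, fun n hn => (hdist n N).trans_lt ?_⟩
    have h1 := hN n hn
    rw [lt_div_iff₀ (by positivity)] at h1
    nlinarith [dist_nonneg (x := V n) (y := V N)]
  obtain ⟨u, hu⟩ := cauchySeq_tendsto_of_complete hcau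
  refine ⟨u, fun K hK => memLp_restrict_of_wtMeasure (Lp.memLp u) hK, fun φ hφ i => ?_⟩
  -- Both sides are limits of the classical integration by parts for the test functions.
  have hg : MemLp (fun y => pd i φ y / wt y) 2 (wtMeasure d) := by
    have hc : Continuous fun y => pd i φ y / wt y :=
      (contDiff_pd hφ.1 i).continuous.div continuous_wt fun y => (wt_pos y).ne'
    refine hc.memLp_of_hasCompactSupport ?_
    simp only [div_eq_mul_inv]
    exact (hasCompactSupport_pd hφ.2 i).mul_right
  have hleft : ∀ f : Lp ℝ 2 (wtMeasure d),
      ∫ y, f y * pd i φ y = inner ℝ (hg.toLp _) f := by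
    intro f
    rw [integral_mul_eq_wtMeasure, L2.inner_def]
    refine integral_congr_ae ?_
    filter_upwards [hg.coeFn_toLp] with y hy
    rw [hy]
    simp
  have hφv : MemLp (fun y => φ y • (EuclideanSpace.single i 1 : E d)) 2 volume :=
    (hφ.1.continuous.smul continuous_const).memLp_of_hasCompactSupport
      (hφ.2.smul_right (f' := fun _ => (EuclideanSpace.single i 1 : E d)))
  have hright : ∀ f : Lp (E d) 2 (volume : Measure (E d)),
      ∫ y, f y i * φ y = inner ℝ (hφv.toLp _) f := by
    intro f
    rw [L2.inner_def]
    refine integral_congr_ae ?_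
    filter_upwards [hφv.coeFn_toLp] with y hy
    rw [hy, inner_smul_left, EuclideanSpace.inner_single_left]
    simp [mul_comm]
  have hl : Tendsto (fun n => (inner ℝ (hg.toLp _) (U n) : ℝ)) atTop
      (𝓝 (inner ℝ (hg.toLp _) u)) := tendsto_const_nhds.inner hu
  have hr : Tendsto (fun n => -(inner ℝ (hφv.toLp _) (V n) : ℝ)) atTop
      (𝓝 (-inner ℝ (hφv.toLp _) v)) := (tendsto_const_nhds.inner hlim).neg
  rw [hleft, hright]
  refine tendsto_nhds_unique hl (hr.congr fun n => ?_)
  rw [← hleft, ← hright, integral_mul_eq_wtMeasure (U n)]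
  have h1 : ∫ y, (U n) y * (pd i φ y / wt y) ∂(wtMeasure d) =
      ∫ y, (ψ n y - m n) * (pd i φ y / wt y) ∂(wtMeasure d) := by
    refine integral_congr_ae ?_
    filter_upwards [(hmem (hψ n) (m n)).coeFn_toLp] with y hy
    rw [hU, hy]
  have h2 : ∫ y, V n y i * φ y = ∫ y, pd i (ψ n) y * φ y := by
    refine integral_congr_ae ?_
    filter_upwards [(hψ n).memLp_gradE.coeFn_toLp] with y hy
    rw [hVψ, hy, gradE_apply]
  have h3 : pd i (fun y => ψ n y - m n) = pd i (ψ n) := by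
    ext y
    rw [pd, fderiv_sub_const, pd]
  rw [h1, h2, ← integral_mul_eq_wtMeasure (fun y => ψ n y - m n),
    integral_mul_pd_of_isTest ((hψ n).1.sub contDiff_const) hφ, h3]

/-- Existence for the equation on the whole space. The gradient solves the variational problem in
the closure of the gradients of test functions. -/
theorem exists_isSolution {q : Matrix (Fin d) (Fin d) ℝ} (hq : opNorm q ≤ 1 / 2)
    {J : E d → E d} (hJ : MemLp J 2 volume) : ∃ u v, IsSolution (1 + q) J u v := by
  set A : E d →L[ℝ] E d := Matrix.toEuclideanCLM (n := Fin d) (𝕜 := ℝ) (1 + q) with hA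
  set T : Lp (E d) 2 (volume : Measure (E d)) →L[ℝ] Lp (E d) 2 (volume : Measure (E d)) :=
    A.compLpL 2 volume with hT
  have hTf : ∀ f : Lp (E d) 2 (volume : Measure (E d)), ∀ᵐ y, (T f) y = A (f y) := fun f =>
    A.coeFn_compLpL f
  have hco : ∀ v, 1 / 2 * ‖v‖ ^ 2 ≤ inner ℝ v (T v) := by
    intro v
    rw [← real_inner_self_eq_norm_sq, L2.inner_def, L2.inner_def, ← integral_const_mul]
    refine integral_mono_ae ((L2.integrable_inner v v).const_mul _) (L2.integrable_inner v (T v)) ?_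
    filter_upwards [hTf v] with y hy
    rw [hy, hA, ← sum_mul_eq_inner, real_inner_self_eq_norm_sq]
    exact half_norm_sq_le hq _
  obtain ⟨v, hvG, hv⟩ := exists_lax_milgram (testGrad d).topologicalClosure
    (Submodule.isClosed_topologicalClosure _) T one_half_pos hco (hJ.toLp J)
  obtain ⟨u, hu1, hu2⟩ := exists_potential hvG
  refine ⟨u, v, hu1, Lp.memLp v, hu2, fun ψ hψ => ?_⟩
  have hmem : hψ.memLp_gradE.toLp (gradE ψ) ∈ (testGrad d).topologicalClosure :=
    Submodule.le_topologicalClosure _ ⟨ψ, hψ, hψ.memLp_gradE.coeFn_toLp⟩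
  have h1 := hv _ hmem
  rw [L2.inner_def, L2.inner_def] at h1
  convert h1 using 1
  · refine integral_congr_ae ?_
    filter_upwards [hTf (hψ.memLp_gradE.toLp (gradE ψ)), hψ.memLp_gradE.coeFn_toLp] with y hy hy'
    rw [hy, hy', hA, ← sum_mul_eq_inner]
    rfl
  · refine integral_congr_ae ?_
    filter_upwards [hJ.coeFn_toLp, hψ.memLp_gradE.coeFn_toLp] with y hy hy'
    rw [hy, hy', PiLp.inner_apply]
    simp [mul_comm]

theorem IsSolution.curl_free {A : Matrix (Fin d) (Fin d) ℝ} {J : E d → E d} {u : E d → ℝ}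
    {v : E d → E d} (h : IsSolution A J u v) {ψ : E d → ℝ} (hψ : IsTest ψ) (i j : Fin d) :
    ∫ y, v y i * pd j ψ y = ∫ y, v y j * pd i ψ y := by
  have h1 := h.weak_grad _ (hψ.pd j) i
  have h2 := h.weak_grad _ (hψ.pd i) j
  simp only [pd_comm hψ.1 j i] at h2
  linarith

theorem posSemidef_one_add {q : Matrix (Fin d) (Fin d) ℝ} (hs : q.IsSymm)
    (hq : opNorm q ≤ 1 / 2) : (1 + q).PosSemidef := by
  refine Matrix.PosSemidef.of_dotProduct_mulVec_nonneg ?_ fun x => ?_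
  · have : (1 + q).IsSymm := Matrix.isSymm_one.add hs
    rwa [Matrix.IsHermitian, Matrix.conjTranspose_eq_transpose_of_trivial]
  · have h1 := half_norm_sq_le hq (WithLp.toLp 2 x)
    rw [sum_mul_eq_inner, Matrix.inner_toEuclideanCLM] at h1
    exact le_trans (by positivity) h1

theorem trace_one_add_pos (hd : 1 ≤ d) {q : Matrix (Fin d) (Fin d) ℝ}
    (hq : opNorm q ≤ 1 / 2) : 0 < (1 + q).trace := by
  have : Nonempty (Fin d) := ⟨⟨0, hd⟩⟩
  refine Finset.sum_pos (fun i _ => ?_) Finset.univ_nonempty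
  have h1 := (abs_le.1 ((abs_entry_le q i i).trans hq)).1
  simp only [Matrix.diag_apply, Matrix.add_apply, Matrix.one_apply_eq]
  linarith

theorem IsSolution.locallyIntegrable {A : Matrix (Fin d) (Fin d) ℝ} {J : E d → E d} {u : E d → ℝ}
    {v : E d → E d} (h : IsSolution A J u v) : LocallyIntegrable u := by
  rw [locallyIntegrable_iff]
  intro K hK
  have : IsFiniteMeasure (volume.restrict K) := isFiniteMeasure_restrict.2 hK.measure_lt_top.ne
  exact (h.memLp_loc K hK).integrable one_le_two

/-- Uniqueness for the equation on the whole space, up to a constant in the potential. -/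
theorem isSolution_unique (hd : 1 ≤ d) {q : Matrix (Fin d) (Fin d) ℝ} (hs : q.IsSymm)
    (hq : opNorm q ≤ 1 / 2) {J : E d → E d} {u u' : E d → ℝ}
    {v v' : E d → E d} (h : IsSolution (1 + q) J u v) (h' : IsSolution (1 + q) J u' v') :
    v =ᵐ[volume] v' ∧ ∃ c : ℝ, ∀ᵐ y, u y - u' y = c := by
  have hi : ∀ {w : E d → E d}, MemLp w 2 volume → ∀ {ψ}, IsTest ψ → ∀ i,
      Integrable fun y => w y i * ψ y := fun hw _ hψ i =>
    integrable_mul_of_memLp (memLp_coord hw i) hψ.memLp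
  have hv : v =ᵐ[volume] v' := by
    have h0 : v - v' =ᵐ[volume] 0 := by
      refine ae_eq_zero_of_curl_free (posSemidef_one_add hs hq) (trace_one_add_pos hd hq)
        (h.memLp_grad.sub h'.memLp_grad) (fun ψ hψ i j => ?_) fun ψ hψ => ?_
      · simp only [Pi.sub_apply, PiLp.sub_apply, sub_mul]
        rw [integral_sub (hi h.memLp_grad (hψ.pd j) i) (hi h'.memLp_grad (hψ.pd j) i),
          integral_sub (hi h.memLp_grad (hψ.pd i) j) (hi h'.memLp_grad (hψ.pd i) j),
          h.curl_free hψ i j, h'.curl_free hψ i j]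
      · have h1 := h.equation ψ hψ
        rw [← h'.equation ψ hψ, ← sub_eq_zero, ← integral_sub] at h1
        · rw [← h1]
          refine integral_congr_ae (Eventually.of_forall fun y => ?_)
          simp only [← Finset.sum_sub_distrib]
          refine Finset.sum_congr rfl fun i _ => Finset.sum_congr rfl fun j _ => ?_
          simp only [Pi.sub_apply, PiLp.sub_apply]
          ring
        all_goals
          refine integrable_finsetSum _ fun i _ => integrable_finsetSum _ fun j _ => ?_
          simp only [mul_assoc]
        · exact (hi h.memLp_grad (hψ.pd j) i).const_mul _
        · exact (hi h'.memLp_grad (hψ.pd j) i).const_mul _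
    filter_upwards [h0] with y hy
    exact sub_eq_zero.1 hy
  refine ⟨hv, ae_eq_const_of_weak_grad_zero (h.locallyIntegrable.sub h'.locallyIntegrable)
    fun ψ hψ i => ?_⟩
  have hu : ∀ {w : E d → ℝ}, LocallyIntegrable w → Integrable fun y => w y * pd i ψ y := by
    intro w hw
    exact hw.integrable_smul_right_of_hasCompactSupport (contDiff_pd hψ.1 i).continuous
      (hasCompactSupport_pd hψ.2 i)
  simp only [sub_mul]
  rw [integral_sub (hu h.locallyIntegrable) (hu h'.locallyIntegrable), h.weak_grad ψ hψ i,
    h'.weak_grad ψ hψ i, sub_eq_zero, neg_inj]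
  refine integral_congr_ae ?_
  filter_upwards [hv] with y hy
  rw [hy]

end Existence

/-! ### Lattice cells, averages and samples -/

section Cells

variable {d n : ℕ}

theorem cube_eq_preimage (z : E d) (s : ℝ) :
    cube z s = WithLp.ofLp ⁻¹' Set.univ.pi fun i => Set.Ioo (z i - s / 2) (z i + s / 2) := by
  ext y
  simp only [cube, Set.mem_ofPred_eq, Set.mem_preimage, Set.mem_univ_pi, Set.mem_Ioo, abs_lt]
  refine forall_congr' fun i => ⟨fun h => ⟨by linarith, by linarith⟩,
    fun h => ⟨by linarith, by linarith⟩⟩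

theorem measurableSet_cube (z : E d) (s : ℝ) : MeasurableSet (cube z s) := by
  rw [cube_eq_preimage]
  exact (WithLp.measurable_ofLp 2 _) (MeasurableSet.univ_pi fun i => measurableSet_Ioo)

theorem volume_cube (z : E d) (s : ℝ) : volume (cube z s) = ENNReal.ofReal s ^ d := by
  rw [cube_eq_preimage, (PiLp.volume_preserving_ofLp (Fin d)).measure_preimage
    (MeasurableSet.univ_pi fun i => measurableSet_Ioo).nullMeasurableSet, Real.volume_pi_Ioo]
  simp

/-- The point of the lattice `ε ℤ^d` nearest to `y`; ties are rounded up in each coordinate. -/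
noncomputable def rnd (ε : ℝ) (y : E d) : E d := WithLp.toLp 2 fun i => ε * round (y i / ε)

theorem norm_le_of_abs_coord_le {v : E d} {c : ℝ} (h : ∀ i, |v i| ≤ c) : ‖v‖ ≤ c * d := by
  have hsum : v = ∑ i, EuclideanSpace.single i (v i) := by
    ext i
    simp
  rw [hsum]
  refine (norm_sum_le _ _).trans ?_
  refine (Finset.sum_le_card_nsmul _ _ c fun i _ => ?_).trans (by simp [mul_comm])
  rw [PiLp.norm_single]
  exact h i

theorem norm_rnd_sub_le {ε : ℝ} (hε : 0 < ε) (y : E d) : ‖rnd ε y - y‖ ≤ ε * d := by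
  refine norm_le_of_abs_coord_le fun i => ?_
  have h1 := abs_sub_round (y i / ε)
  have h2 : (rnd ε y - y) i = -(ε * (y i / ε - round (y i / ε))) := by
    simp only [rnd, PiLp.sub_apply]
    field_simp
    ring
  rw [h2, abs_neg, abs_mul, abs_of_pos hε]
  nlinarith

theorem tendsto_rnd {ε : ℕ → ℝ} (hε : ∀ k, 0 < ε k) (hε0 : Tendsto ε atTop (𝓝 0)) (y : E d) :
    Tendsto (fun k => rnd (ε k) y) atTop (𝓝 y) := by
  rw [tendsto_iff_norm_sub_tendsto_zero]
  refine squeeze_zero (fun _ => norm_nonneg _) (fun k => norm_rnd_sub_le (hε k) y) ?_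
  simpa using hε0.mul_const (d : ℝ)

/-- Every function of the nearest lattice point is measurable. -/
theorem stronglyMeasurable_comp_rnd (ε : ℝ) (f : E d → E d) :
    StronglyMeasurable fun y => f (rnd ε y) := by
  have h1 : Measurable fun y : E d => fun i : Fin d => round (y i / ε) := by
    refine measurable_pi_lambda _ fun i => ?_
    simp only [round_eq]
    exact Int.measurable_floor.comp
      ((((EuclideanSpace.proj i : E d →L[ℝ] ℝ).measurable).div_const ε).add_const _)
  have h2 : Measurable fun k : Fin d → ℤ => f (WithLp.toLp 2 fun i => ε * (k i : ℝ)) :=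
    measurable_of_countable _
  exact (h2.comp h1).stronglyMeasurable

theorem rnd_eq_of_mem_cube {ε : ℝ} (hε : 0 < ε) {x : Torus d n} {y : E d}
    (hy : y ∈ cube (ε • pos x) ε) : rnd ε y = ε • pos x := by
  ext i
  have h1 := hy i
  simp only [rnd, pos, PiLp.smul_apply, smul_eq_mul] at h1 ⊢
  congr 2
  rw [round_eq, Int.floor_eq_iff]
  rw [abs_lt] at h1
  constructor
  · have : (((x i).valMinAbs : ℝ) - 1 / 2) * ε ≤ y i := by linarith
    have := (le_div_iff₀ hε).2 this
    linarith
  · have : y i < (((x i).valMinAbs : ℝ) + 1 / 2) * ε := by linarith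
    have := (div_lt_iff₀ hε).2 this
    linarith

theorem pos_injective : Function.Injective (pos (d := d) (n := n)) := by
  intro x x' h
  ext i
  have h1 := congrArg (fun v : E d => v i) h
  simp only [pos, Int.cast_inj] at h1
  exact ZMod.injective_valMinAbs h1

theorem pairwise_disjoint_cube {ε : ℝ} (hε : 0 < ε) :
    Pairwise (Function.onFun Disjoint fun x : Torus d n => cube (ε • pos x) ε) := by
  intro x x' hne
  refine Set.disjoint_left.2 fun y hy hy' => hne (pos_injective ?_)
  have h := (rnd_eq_of_mem_cube hε hy).symm.trans (rnd_eq_of_mem_cube hε hy')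
  exact smul_right_injective _ hε.ne' h

/-- The union of the cells of the torus of side length `n` and lattice spacing `ε`. -/
def cells (d n : ℕ) (ε : ℝ) : Set (E d) := ⋃ x : Torus d n, cube (ε • pos x) ε

theorem measurableSet_cells [NeZero n] (ε : ℝ) : MeasurableSet (cells d n ε) :=
  MeasurableSet.iUnion fun _ => measurableSet_cube _ _

theorem sum_setIntegral_cube [NeZero n] {ε : ℝ} (hε : 0 < ε) {f : E d → ℝ} (hf : Integrable f) :
    ∑ x : Torus d n, ∫ y in cube (ε • pos x) ε, f y = ∫ y in cells d n ε, f y :=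
  (integral_iUnion_fintype (fun _ => measurableSet_cube _ _) (pairwise_disjoint_cube hε)
    fun _ => hf.integrableOn).symm

/-- The rescaled cell averages of a field on the lattice of spacing `ε`. -/
noncomputable def avgField (ε : ℝ) (F : E d → E d) (x : Torus d n) : E d :=
  √(ε ^ d) • ⨍ y in cube (ε • pos x) ε, F y

/-- The rescaled point values of a field on the lattice of spacing `ε`. -/
noncomputable def sampField (ε : ℝ) (f : E d → E d) (x : Torus d n) : E d :=
  √(ε ^ d) • f (ε • pos x)

theorem volume_real_cube {ε : ℝ} (hε : 0 < ε) (z : E d) :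
    (volume.restrict (cube z ε)).real Set.univ = ε ^ d := by
  rw [measureReal_restrict_apply MeasurableSet.univ, Set.univ_inter, Measure.real, volume_cube,
    ENNReal.toReal_pow, ENNReal.toReal_ofReal hε.le]

instance (z : E d) (ε : ℝ) : IsFiniteMeasure (volume.restrict (cube z ε)) :=
  isFiniteMeasure_restrict.2 (by rw [volume_cube]; exact ENNReal.pow_ne_top ENNReal.ofReal_ne_top)

theorem integrableOn_cube {F : E d → E d} (hF : MemLp F 2 volume) (z : E d) (ε : ℝ) :
    IntegrableOn F (cube z ε) :=
  (hF.restrict _).integrable one_le_two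

theorem avgField_eq {ε : ℝ} (hε : 0 < ε) (F : E d → E d) (x : Torus d n) :
    avgField ε F x = (√(ε ^ d) * (ε ^ d)⁻¹) • ∫ y in cube (ε • pos x) ε, F y := by
  rw [avgField, average_eq, volume_real_cube hε, smul_smul]

theorem avgField_congr {ε : ℝ} {F G : E d → E d} (h : F =ᵐ[volume] G) :
    avgField (n := n) ε F = avgField ε G := by
  ext x : 1
  rw [avgField, avgField]
  congr 1
  exact average_congr (ae_restrict_of_ae h)

theorem avgField_add {ε : ℝ} (hε : 0 < ε) {F G : E d → E d} (hF : MemLp F 2 volume)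
    (hG : MemLp G 2 volume) (x : Torus d n) :
    avgField ε (F + G) x = avgField ε F x + avgField ε G x := by
  simp only [avgField_eq hε, Pi.add_apply]
  rw [integral_add (integrableOn_cube hF _ _) (integrableOn_cube hG _ _), smul_add]

theorem avgField_smul {ε : ℝ} (hε : 0 < ε) (c : ℝ) (F : E d → E d) (x : Torus d n) :
    avgField ε (c • F) x = c • avgField ε F x := by
  simp only [avgField_eq hε, Pi.smul_apply]
  rw [integral_smul, smul_comm]

/-- Jensen's inequality on the cells. -/
theorem l2norm_sampField_sub_avgField_sq_le [NeZero n] {ε : ℝ} (hε : 0 < ε) {f F : E d → E d}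
    (hF : MemLp F 2 volume) (hf : MemLp (fun y => f (rnd ε y)) 2 volume) :
    l2norm (fun x : Torus d n => sampField ε f x - avgField ε F x) ^ 2 ≤
      ∫ y, ‖f (rnd ε y) - F y‖ ^ 2 := by
  have hint : Integrable fun y => ‖f (rnd ε y) - F y‖ ^ 2 := (hf.sub hF).norm.integrable_sq
  rw [l2norm_sq]
  refine le_trans ?_ (setIntegral_le_integral (s := cells d n ε) hint
    (Eventually.of_forall fun y => sq_nonneg _))
  rw [← sum_setIntegral_cube hε hint]
  refine Finset.sum_le_sum fun x _ => ?_
  set μ := volume.restrict (cube (ε • pos x) ε) with hμ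
  have hpos : 0 < ε ^ d := by positivity
  have hμ0 : μ.real Set.univ = ε ^ d := volume_real_cube hε _
  have : NeZero μ := ⟨fun h => by rw [h] at hμ0; simp at hμ0; exact hpos.ne hμ0⟩
  have h1 : sampField ε f x - avgField ε F x = √(ε ^ d) • ⨍ y, (f (ε • pos x) - F y) ∂μ := by
    rw [sampField, avgField, ← smul_sub]
    congr 1
    rw [average_eq, average_eq, integral_sub (integrable_const _) (integrableOn_cube hF _ _),
      smul_sub, integral_const, smul_smul, inv_mul_cancel₀ (by rw [hμ0]; exact hpos.ne'), one_smul]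
  have hae : ∀ᵐ y ∂μ, f (ε • pos x) - F y = f (rnd ε y) - F y := by
    filter_upwards [ae_restrict_mem (measurableSet_cube _ _)] with y hy
    rw [rnd_eq_of_mem_cube hε hy]
  have hg : ConvexOn ℝ Set.univ fun v : E d => ‖v‖ ^ 2 :=
    convexOn_univ_norm.pow (fun _ _ => norm_nonneg _) 2
  have h2 := hg.map_average_le (μ := μ) (f := fun y => f (ε • pos x) - F y)
    (continuous_norm.pow 2).continuousOn isClosed_univ (Eventually.of_forall fun _ => Set.mem_univ _)
    ((integrable_const _).sub (integrableOn_cube hF _ _))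
    (hint.integrableOn.congr (by filter_upwards [hae] with y hy; simp [hy]))
  rw [h1, norm_smul, mul_pow, Real.norm_eq_abs, sq_abs, Real.sq_sqrt hpos.le]
  refine (mul_le_mul_of_nonneg_left h2 hpos.le).trans_eq ?_
  rw [average_eq, hμ0, smul_eq_mul, mul_inv_cancel_left₀ hpos.ne']
  refine integral_congr_ae ?_
  filter_upwards [hae] with y hy
  simp only [hy]

/-- Averaging is a contraction from `L²` to `ℓ²`. -/
theorem l2norm_avgField_le [NeZero n] {ε : ℝ} (hε : 0 < ε) {F : E d → E d}
    (hF : MemLp F 2 volume) :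
    l2norm (avgField ε F : Torus d n → E d) ≤ ‖hF.toLp F‖ := by
  have h1 := l2norm_sampField_sub_avgField_sq_le (n := n) hε (f := fun _ => 0) hF MemLp.zero'
  refine le_of_sq_le_sq ?_ (norm_nonneg _)
  rw [← real_inner_self_eq_norm_sq, L2.inner_def]
  have h2 : ∫ y, inner ℝ (hF.toLp F y) (hF.toLp F y) = ∫ y, ‖F y‖ ^ 2 := by
    refine integral_congr_ae ?_
    filter_upwards [hF.coeFn_toLp] with y hy
    rw [hy, real_inner_self_eq_norm_sq]
  rw [h2]
  simpa [sampField, l2norm_sq] using h1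

theorem sum_inner_avgField_sampField [NeZero n] {ε : ℝ} (hε : 0 < ε) {J f : E d → E d}
    (hJ : MemLp J 2 volume) (hf : MemLp (fun y => f (rnd ε y)) 2 volume) :
    ∑ x : Torus d n, inner ℝ (avgField ε J x) (sampField ε f x) =
      ∫ y in cells d n ε, inner ℝ (J y) (f (rnd ε y)) := by
  have hint : Integrable fun y => (inner ℝ (J y) (f (rnd ε y)) : ℝ) := by
    have := L2.integrable_inner (𝕜 := ℝ) (hJ.toLp J) (hf.toLp _)
    refine this.congr ?_
    filter_upwards [hJ.coeFn_toLp, hf.coeFn_toLp] with y h1 h2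
    rw [h1, h2]
  rw [← sum_setIntegral_cube hε hint]
  refine Finset.sum_congr rfl fun x _ => ?_
  have hpos : 0 < ε ^ d := by positivity
  rw [avgField_eq hε, sampField, inner_smul_left, inner_smul_right, real_inner_comm,
    ← integral_inner (integrableOn_cube hJ _ _)]
  have h1 : √(ε ^ d) * (ε ^ d)⁻¹ * √(ε ^ d) = 1 := by
    rw [mul_right_comm, Real.mul_self_sqrt hpos.le, mul_inv_cancel₀ hpos.ne']
  simp only [conj_trivial]
  rw [← mul_assoc, h1, one_mul]
  refine setIntegral_congr_fun (measurableSet_cube _ _) fun y hy => ?_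
  rw [rnd_eq_of_mem_cube hε hy, real_inner_comm]

/-- The coordinate hyperplanes are null sets. -/
theorem ae_coord_ne (i : Fin d) (c : ℝ) : ∀ᵐ y : E d, y i ≠ c := by
  have h1 : ∀ᵐ f : Fin d → ℝ, f i ≠ c := Measure.ae_eval_ne (μ := fun _ : Fin d => (volume : Measure ℝ)) i c
  exact (PiLp.volume_preserving_ofLp (Fin d)).quasiMeasurePreserving.ae h1

/-- Away from the half-integer hyperplanes, the points in the interior of the fundamental cube lie in
some open cell. -/
theorem mem_cells [NeZero n] {ε : ℝ} (hε : 0 < ε) {y : E d}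
    (h1 : ∀ i, ∀ k : ℤ, y i ≠ ε * (k + 1 / 2)) (h2 : ∀ i, 2 * |y i| < ε * (n - 1)) :
    y ∈ cells d n ε := by
  refine Set.mem_iUnion.2 ⟨fun i => (round (y i / ε) : ℤ), fun i => ?_⟩
  have h3 := abs_sub_round (y i / ε)
  have hval : ((round (y i / ε) : ℤ) : ZMod n).valMinAbs = round (y i / ε) := by
    rw [ZMod.valMinAbs_spec]
    refine ⟨rfl, ?_⟩
    have h4 : 2 * |y i / ε| < n - 1 := by
      rw [abs_div, abs_of_pos hε, ← mul_div_assoc, div_lt_iff₀ hε]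
      linarith [h2 i]
    rw [abs_le] at h3
    have h5 := abs_lt.1 (show |y i / ε| < (n - 1) / 2 by linarith)
    constructor
    · have : -(n : ℝ) < (round (y i / ε) : ℝ) * 2 := by linarith
      exact_mod_cast this
    · have : (round (y i / ε) : ℝ) * 2 ≤ n := by linarith
      exact_mod_cast this
  simp only [pos, PiLp.smul_apply, hval, smul_eq_mul]
  have h6 : y i - ε * round (y i / ε) = ε * (y i / ε - round (y i / ε)) := by
    field_simp
  rw [h6, abs_mul, abs_of_pos hε]
  have hne : |y i / ε - round (y i / ε)| ≠ 1 / 2 := by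
    intro h
    rcases (abs_eq (by norm_num)).1 h with h | h
    · apply h1 i (round (y i / ε))
      field_simp at h ⊢
      linarith
    · apply h1 i (round (y i / ε) - 1)
      push_cast
      field_simp at h ⊢
      linarith
  nlinarith [lt_of_le_of_ne h3 hne]

end Cells

/-! ### Convergence of samples and averages -/

section Limits

variable {d : ℕ}

theorem exists_radius {F : Type*} [Zero F] {g : E d → F} (hg : HasCompactSupport g) :
    ∃ R, ∀ y, R < ‖y‖ → g y = 0 := by
  obtain ⟨R, hR⟩ := hg.isCompact.isBounded.subset_closedBall (0 : E d)
  refine ⟨R, fun y hy => image_eq_zero_of_notMem_tsupport fun h => ?_⟩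
  have := hR h
  rw [mem_closedBall_zero_iff] at this
  linarith

theorem memLp_of_bound_of_ball {g : E d → E d} (hg : AEStronglyMeasurable g volume) {M R : ℝ}
    (hM : ∀ᵐ y, ‖g y‖ ≤ M) (hR : ∀ᵐ y, R < ‖y‖ → g y = 0) : MemLp g 2 volume := by
  refine (memLp_indicator_const 2 (measurableSet_closedBall (x := (0 : E d)) (ε := R)) M
    (Or.inr measure_closedBall_lt_top.ne)).mono hg ?_
  filter_upwards [hM, hR] with y h1 h2
  by_cases hy : ‖y‖ ≤ R
  · rw [Set.indicator_of_mem (by simpa using hy)]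
    exact h1.trans (le_abs_self M)
  · rw [h2 (not_le.1 hy), norm_zero]
    exact norm_nonneg _

/-- A family of fields whose values at the lattice points next to `y` converge to `F y`, with
uniform bounds; this covers a fixed regular field as well as difference quotients. -/
structure SampleConv (ε : ℕ → ℝ) (f : ℕ → E d → E d) (F : E d → E d) : Prop where
  bound : ∃ M, ∀ k y, ‖f k y‖ ≤ M
  supp : ∃ R, ∀ k y, R < ‖y‖ → f k y = 0
  lim : ∀ᵐ y, Tendsto (fun k => f k (rnd (ε k) y)) atTop (𝓝 (F y))

variable {ε : ℕ → ℝ} {f : ℕ → E d → E d} {F : E d → E d}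

theorem SampleConv.supp_rnd (h : SampleConv ε f F) (hε : ∀ k, 0 < ε k) (hε1 : ∀ k, ε k ≤ 1) :
    ∃ R, ∀ k y, R < ‖y‖ → f k (rnd (ε k) y) = 0 := by
  obtain ⟨R, hR⟩ := h.supp
  refine ⟨R + d, fun k y hy => hR k _ ?_⟩
  have h1 := norm_rnd_sub_le (hε k) y
  have h2 : ε k * d ≤ d := mul_le_of_le_one_left (Nat.cast_nonneg d) (hε1 k)
  have h3 := norm_sub_norm_le y (rnd (ε k) y)
  rw [norm_sub_rev] at h3
  linarith

theorem SampleConv.memLp_rnd (h : SampleConv ε f F) (hε : ∀ k, 0 < ε k) (hε1 : ∀ k, ε k ≤ 1)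
    (k : ℕ) : MemLp (fun y => f k (rnd (ε k) y)) 2 volume := by
  obtain ⟨R, hR⟩ := h.supp_rnd hε hε1
  obtain ⟨M, hM⟩ := h.bound
  exact memLp_of_bound_of_ball (stronglyMeasurable_comp_rnd _ _).aestronglyMeasurable
    (Eventually.of_forall fun y => hM k _) (Eventually.of_forall fun y => hR k y)

theorem SampleConv.ae_limit (h : SampleConv ε f F) (hε : ∀ k, 0 < ε k) (hε1 : ∀ k, ε k ≤ 1) :
    ∃ M R, (∀ k y, ‖f k (rnd (ε k) y)‖ ≤ M) ∧ (∀ k y, R < ‖y‖ → f k (rnd (ε k) y) = 0) ∧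
      (∀ᵐ y, ‖F y‖ ≤ M) ∧ ∀ᵐ y, R < ‖y‖ → F y = 0 := by
  obtain ⟨R, hR⟩ := h.supp_rnd hε hε1
  obtain ⟨M, hM⟩ := h.bound
  refine ⟨M, R, fun k y => hM k _, hR, ?_, ?_⟩
  · filter_upwards [h.lim] with y hy
    exact le_of_tendsto hy.norm (Eventually.of_forall fun k => hM k _)
  · filter_upwards [h.lim] with y hy hyR
    simp only [hR _ y hyR] at hy
    exact tendsto_nhds_unique hy tendsto_const_nhds

theorem SampleConv.memLp (h : SampleConv ε f F) (hε : ∀ k, 0 < ε k) (hε1 : ∀ k, ε k ≤ 1) :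
    MemLp F 2 volume := by
  obtain ⟨M, R, -, -, hM, hR⟩ := h.ae_limit hε hε1
  exact memLp_of_bound_of_ball (aestronglyMeasurable_of_tendsto_ae atTop
    (fun k => (stronglyMeasurable_comp_rnd (ε k) (f k)).aestronglyMeasurable) h.lim) hM hR

theorem SampleConv.tendsto_integral (h : SampleConv ε f F) (hε : ∀ k, 0 < ε k)
    (hε1 : ∀ k, ε k ≤ 1) :
    Tendsto (fun k => ∫ y, ‖f k (rnd (ε k) y) - F y‖ ^ 2) atTop (𝓝 0) := by
  obtain ⟨M, R, hM, hR, hM', hR'⟩ := h.ae_limit hε hε1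
  have hlim := tendsto_integral_of_dominated_convergence
    (F := fun k y => ‖f k (rnd (ε k) y) - F y‖ ^ 2) (f := fun _ : E d => (0 : ℝ)) (μ := volume)
    ((Metric.closedBall (0 : E d) R).indicator fun _ => (M + M) ^ 2)
    (fun k => (((h.memLp_rnd hε hε1 k).sub (h.memLp hε hε1)).norm.integrable_sq).1)
    ((integrable_indicator_iff measurableSet_closedBall).2
      (integrableOn_const measure_closedBall_lt_top.ne)) ?_ ?_
  · simpa using hlim
  · intro k
    filter_upwards [hM', hR'] with y h1 h2
    rw [Real.norm_of_nonneg (sq_nonneg _)]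
    by_cases hy : ‖y‖ ≤ R
    · rw [Set.indicator_of_mem (by simpa using hy)]
      gcongr
      exact (norm_sub_le _ _).trans (add_le_add (hM k y) h1)
    · rw [h2 (not_le.1 hy), hR k y (not_le.1 hy)]
      simp [Set.indicator_nonneg, sq_nonneg]
  · filter_upwards [h.lim] with y hy
    simpa using ((hy.sub_const (F y)).norm.pow 2)

variable {n : ℕ → ℕ} [∀ k, NeZero (n k)]

/-- Samples and averages agree asymptotically in `ℓ²`, whatever the size of the tori. -/
theorem SampleConv.tendsto_l2norm (h : SampleConv ε f F) (hε : ∀ k, 0 < ε k)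
    (hε1 : ∀ k, ε k ≤ 1) :
    Tendsto (fun k => l2norm fun x : Torus d (n k) =>
      sampField (ε k) (f k) x - avgField (ε k) F x) atTop (𝓝 0) := by
  have h1 : Tendsto (fun k => l2norm (fun x : Torus d (n k) =>
      sampField (ε k) (f k) x - avgField (ε k) F x) ^ 2) atTop (𝓝 0) :=
    squeeze_zero (fun _ => sq_nonneg _) (fun k => l2norm_sampField_sub_avgField_sq_le (hε k)
      (h.memLp hε hε1) (h.memLp_rnd hε hε1 k)) (h.tendsto_integral hε hε1)
  have h2 := h1.sqrt
  simp only [Real.sqrt_zero] at h2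
  exact h2.congr fun k => Real.sqrt_sq (l2norm_nonneg _)

/-- The cells of growing tori exhaust the space up to a null set. -/
theorem ae_eventually_mem_cells (hε : ∀ k, 0 < ε k)
    (hn : Tendsto (fun k => ε k * ((n k : ℝ) - 1)) atTop atTop) :
    ∀ᵐ y : E d, ∀ᶠ k in atTop, y ∈ cells d (n k) (ε k) := by
  have h1 : ∀ᵐ y : E d, ∀ (k : ℕ) (i : Fin d) (m : ℤ), y i ≠ ε k * (m + 1 / 2) := by
    rw [ae_all_iff]; intro k
    rw [ae_all_iff]; intro i
    rw [ae_all_iff]; intro m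
    exact ae_coord_ne i _
  filter_upwards [h1] with y hy
  have h2 : ∀ i, ∀ᶠ k in atTop, 2 * |y i| < ε k * ((n k : ℝ) - 1) := fun i =>
    hn.eventually_gt_atTop _
  filter_upwards [eventually_all.2 h2] with k hk
  exact mem_cells (hε k) (hy k) hk

theorem tendsto_setIntegral_cells (hε : ∀ k, 0 < ε k)
    (hn : Tendsto (fun k => ε k * ((n k : ℝ) - 1)) atTop atTop) {g : E d → ℝ}
    (hg : Integrable g) :
    Tendsto (fun k => ∫ y in cells d (n k) (ε k), g y) atTop (𝓝 (∫ y, g y)) := by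
  simp only [← integral_indicator (measurableSet_cells _)]
  refine tendsto_integral_of_dominated_convergence (fun y => ‖g y‖)
    (fun k => hg.1.indicator (measurableSet_cells _)) hg.norm
    (fun k => Eventually.of_forall fun y => norm_indicator_le_norm_self _ _) ?_
  filter_upwards [ae_eventually_mem_cells hε hn] with y hy
  refine tendsto_const_nhds.congr' ?_
  filter_upwards [hy] with k hk
  rw [Set.indicator_of_mem hk]

theorem integrable_inner_of_memLp {J G : E d → E d} (hJ : MemLp J 2 volume)
    (hG : MemLp G 2 volume) : Integrable fun y => (inner ℝ (J y) (G y) : ℝ) := by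
  refine (L2.integrable_inner (𝕜 := ℝ) (hJ.toLp J) (hG.toLp G)).congr ?_
  filter_upwards [hJ.coeFn_toLp, hG.coeFn_toLp] with y h1 h2
  rw [h1, h2]

/-- The pairings of averages with samples are Riemann sums for the pairing in `L²`. -/
theorem SampleConv.tendsto_sum_inner (h : SampleConv ε f F) (hε : ∀ k, 0 < ε k)
    (hε1 : ∀ k, ε k ≤ 1) (hn : Tendsto (fun k => ε k * ((n k : ℝ) - 1)) atTop atTop)
    {J : E d → E d} (hJ : MemLp J 2 volume) :
    Tendsto (fun k => ∑ x : Torus d (n k), inner ℝ (avgField (ε k) J x)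
      (sampField (ε k) (f k) x)) atTop (𝓝 (∫ y, inner ℝ (J y) (F y))) := by
  have hF := h.memLp hε hε1
  have h1 := tendsto_setIntegral_cells hε hn (integrable_inner_of_memLp hJ hF)
  have h2 : Tendsto (fun k => ∫ y in cells d (n k) (ε k),
      inner ℝ (J y) (f k (rnd (ε k) y) - F y)) atTop (𝓝 0) := by
    have h3 : Tendsto (fun k => (eLpNorm J 2 volume).toReal *
        √(∫ y, ‖f k (rnd (ε k) y) - F y‖ ^ 2)) atTop (𝓝 0) := by
      simpa using (h.tendsto_integral hε hε1).sqrt.const_mul (eLpNorm J 2 volume).toReal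
    refine squeeze_zero_norm (fun k => ?_) h3
    have hd := (h.memLp_rnd hε hε1 k).sub hF
    refine (abs_integral_inner_le (hJ.restrict _) (hd.restrict _)).trans ?_
    have e1 : (eLpNorm J 2 (volume.restrict (cells d (n k) (ε k)))).toReal ≤
        (eLpNorm J 2 volume).toReal :=
      ENNReal.toReal_mono hJ.2.ne (eLpNorm_mono_measure _ Measure.restrict_le_self)
    have e2 : (eLpNorm ((fun y => f k (rnd (ε k) y)) - F) 2
        (volume.restrict (cells d (n k) (ε k)))).toReal ≤
        √(∫ y, ‖f k (rnd (ε k) y) - F y‖ ^ 2) := by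
      refine (ENNReal.toReal_mono hd.2.ne
        (eLpNorm_mono_measure _ Measure.restrict_le_self)).trans (Real.le_sqrt_of_sq_le ?_)
      rw [← ENNReal.toReal_pow, eLpNorm_two_sq, ← integral_eq_lintegral_of_nonneg_ae
        (Eventually.of_forall fun y => sq_nonneg _) hd.norm.integrable_sq.1]
      exact le_rfl
    exact mul_le_mul e1 e2 ENNReal.toReal_nonneg ENNReal.toReal_nonneg
  have h4 := h1.add h2
  rw [add_zero] at h4
  refine h4.congr fun k => ?_
  have hfk := h.memLp_rnd hε hε1 k
  rw [sum_inner_avgField_sampField (hε k) hJ hfk, ← integral_add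
    (integrable_inner_of_memLp hJ hF).integrableOn
    (g := fun y => inner ℝ (J y) (f k (rnd (ε k) y) - F y))
    (integrable_inner_of_memLp hJ (hfk.sub hF)).integrableOn]
  refine integral_congr_ae (Eventually.of_forall fun y => ?_)
  simp only [inner_sub_right]
  ring

/-! ### Difference quotients of test functions -/

/-- The vector of difference quotients of `ψ` with step `t`. -/
noncomputable def dq (t : ℝ) (ψ : E d → ℝ) (y : E d) : E d :=
  WithLp.toLp 2 fun i => (ψ (y + EuclideanSpace.single i t) - ψ y) / t

theorem tendsto_dq {ψ : E d → ℝ} (hψ : IsTest ψ) {t : ℕ → ℝ} (ht : ∀ k, t k ≠ 0)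
    (ht0 : Tendsto t atTop (𝓝 0)) {z : ℕ → E d} {y : E d} (hz : Tendsto z atTop (𝓝 y)) :
    Tendsto (fun k => dq (t k) ψ (z k)) atTop (𝓝 (gradE ψ y)) := by
  refine ((PiLp.continuous_toLp 2 _).tendsto _).comp (tendsto_pi_nhds.2 fun i => ?_)
  have hs : HasStrictFDerivAt ψ (fderiv ℝ ψ y) y :=
    hψ.1.contDiffAt.hasStrictFDerivAt (by simp)
  have hsingle : Tendsto (fun k => (EuclideanSpace.single i (t k) : E d)) atTop (𝓝 0) := by
    rw [tendsto_zero_iff_norm_tendsto_zero]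
    simpa only [PiLp.norm_single, norm_zero] using ht0.norm
  have hp : Tendsto (fun k => (z k + EuclideanSpace.single i (t k), z k)) atTop (𝓝 (y, y)) := by
    refine Tendsto.prodMk_nhds ?_ hz
    simpa using hz.add hsingle
  have h1 := hs.isLittleO.comp_tendsto hp
  have h2 : (fun k => ψ (z k + EuclideanSpace.single i (t k)) - ψ (z k) - t k * pd i ψ y)
      =o[atTop] t := by
    refine (h1.congr_left fun k => ?_).trans_isBigO (Asymptotics.IsBigO.of_bound 1 ?_)
    · simp only [Function.comp_apply, add_sub_cancel_left]
      rw [fderiv_eq_sum_pd]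
      simp [PiLp.single_apply]
    · exact Eventually.of_forall fun k => by simp
  have h3 := h2.tendsto_div_nhds_zero.add_const (pd i ψ y)
  rw [zero_add] at h3
  refine h3.congr fun k => ?_
  have := ht k
  field_simp
  ring

/-- Linear images of difference quotients satisfy the assumptions on the family of fields. -/
theorem sampleConv_dq {ψ : E d → ℝ} (hψ : IsTest ψ) (T : E d →L[ℝ] E d) (hε : ∀ k, 0 < ε k)
    (hε1 : ∀ k, ε k ≤ 1) (hε0 : Tendsto ε atTop (𝓝 0)) {s : ℝ} (hs : |s| = 1) :
    SampleConv ε (fun k y => T (dq (s * ε k) ψ y)) fun y => T (gradE ψ y) := by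
  have hs0 : s ≠ 0 := fun h => by simp [h] at hs
  have habs : ∀ k, |s * ε k| = ε k := fun k => by rw [abs_mul, hs, one_mul, abs_of_pos (hε k)]
  refine ⟨?_, ?_, Eventually.of_forall fun y => ?_⟩
  · obtain ⟨C, hC⟩ := ContDiff.lipschitzWith_of_hasCompactSupport hψ.2 hψ.1 (by simp)
    refine ⟨‖T‖ * (C * d), fun k y => (T.le_opNorm _).trans ?_⟩
    gcongr
    refine norm_le_of_abs_coord_le fun i => ?_
    have h1 := hC.dist_le_mul (y + EuclideanSpace.single i (s * ε k)) y
    rw [Real.dist_eq, dist_eq_norm, add_sub_cancel_left, PiLp.norm_single, Real.norm_eq_abs] at h1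
    simp only [dq]
    rw [abs_div, habs, div_le_iff₀ (hε k)]
    rwa [habs] at h1
  · obtain ⟨R, hz⟩ := exists_radius hψ.2
    refine ⟨R + 1, fun k y hy => ?_⟩
    have : dq (s * ε k) ψ y = 0 := by
      ext i
      simp only [dq, PiLp.zero_apply]
      rw [hz y (by linarith), hz (y + _), sub_zero, zero_div]
      have h1 := norm_sub_norm_le y (-EuclideanSpace.single i (s * ε k))
      rw [sub_neg_eq_add, norm_neg, PiLp.norm_single, Real.norm_eq_abs, habs] at h1
      linarith [hε1 k]
    rw [this, map_zero]
  · refine (T.continuous.tendsto _).comp (tendsto_dq hψ (fun k => mul_ne_zero hs0 (hε k).ne') ?_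
      (tendsto_rnd hε hε0 y))
    simpa using hε0.const_mul s

end Limits

section Lattice

variable {d n : ℕ} [NeZero n]

/-- For a function supported away from the boundary of the fundamental cube of the torus, shifts
on the torus are shifts in space. -/
theorem apply_pos_add_single {ψ : E d → ℝ} {R ε : ℝ} (hε : 0 < ε) (hR : ∀ y, R < ‖y‖ → ψ y = 0)
    (hn : 2 * R < ε * ((n : ℝ) - 2)) (x : Torus d n) (i : Fin d) {s : ℤ} (hs : |s| = 1) :
    ψ (ε • pos (x + Pi.single i (s : ZMod n))) =
      ψ (ε • pos x + EuclideanSpace.single i (s * ε)) := by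
  set k := (x i).valMinAbs with hk
  set k' := (x i + (s : ZMod n)).valMinAbs with hk'
  have hkmem := (x i).valMinAbs_mem_Ioc
  have hk'mem := (x i + (s : ZMod n)).valMinAbs_mem_Ioc
  rw [← hk] at hkmem
  rw [← hk'] at hk'mem
  by_cases h : k' = k + s
  · congr 1
    ext j
    by_cases hj : j = i
    · subst hj
      simp only [pos, PiLp.smul_apply, PiLp.add_apply, smul_eq_mul, Pi.add_apply,
        Pi.single_eq_same, PiLp.single_apply, if_true]
      rw [← hk', ← hk, h]
      push_cast
      ring
    · simp [pos, hj]
  · -- The shift wraps around; then both points lie outside the support.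
    have hdvd : (n : ℤ) ∣ k' - (k + s) := by
      rw [← ZMod.intCast_zmod_eq_zero_iff_dvd]
      push_cast
      rw [hk', hk, ZMod.coe_valMinAbs, ZMod.coe_valMinAbs, sub_self]
    have hle : (n : ℤ) ≤ |k' - (k + s)| :=
      Int.le_of_dvd (abs_pos.2 (sub_ne_zero.2 h)) ((dvd_abs _ _).2 hdvd)
    have hbig : (n : ℤ) - 2 ≤ 2 * |k'| ∧ (n : ℤ) - 2 ≤ 2 * |k + s| := by
      obtain ⟨h1, h2⟩ := hkmem
      obtain ⟨h3, h4⟩ := hk'mem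
      constructor <;> grind
    have hcoord : ∀ {y : E d} {m : ℤ}, y i = ε * m → (n : ℤ) - 2 ≤ 2 * |m| → ψ y = 0 := by
      intro y m hy hm
      refine hR y ?_
      have h1 : |y i| ≤ ‖y‖ := by
        simpa using PiLp.norm_apply_le y i
      rw [hy, abs_mul, abs_of_pos hε] at h1
      have h2 : (n : ℝ) - 2 ≤ 2 * |(m : ℝ)| := by exact_mod_cast hm
      nlinarith
    rw [hcoord (m := k') _ hbig.1, hcoord (m := k + s) _ hbig.2]
    · simp [pos, ← hk]; ring
    · simp [pos, ← hk']

/-- The restriction of `ψ` to the lattice, rescaled so that its differences are of the size of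
`√(ε^d) ∂ψ`. -/
noncomputable def latticeFun (ε : ℝ) (ψ : E d → ℝ) (x : Torus d n) : ℝ :=
  √(ε ^ d) / ε * ψ (ε • pos x)

/-- For large tori the discrete gradient of the restriction of `ψ` samples its forward difference
quotients. -/
theorem grad_latticeFun {ψ : E d → ℝ} {R ε : ℝ} (hε : 0 < ε) (hR : ∀ y, R < ‖y‖ → ψ y = 0)
    (hn : 2 * R < ε * ((n : ℝ) - 2)) (x : Torus d n) :
    grad (latticeFun ε ψ) x = sampField ε (dq ε ψ) x := by
  ext i
  have h := apply_pos_add_single hε hR hn x i (s := 1) (by simp)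
  simp only [Int.cast_one, one_mul] at h
  simp only [grad_apply, fwd, latticeFun, sampField, dq, PiLp.smul_apply, smul_eq_mul, h]
  field_simp

/-- The adjoint differences of the restriction of `ψ` sample its backward difference quotients, with
the opposite sign. -/
theorem adj_latticeFun {ψ : E d → ℝ} {R ε : ℝ} (hε : 0 < ε) (hR : ∀ y, R < ‖y‖ → ψ y = 0)
    (hn : 2 * R < ε * ((n : ℝ) - 2)) (x : Torus d n) (i : Fin d) :
    adj i (latticeFun ε ψ) x = -sampField ε (dq (-1 * ε) ψ) x i := by
  have h := apply_pos_add_single hε hR hn x i (s := -1) (by simp)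
  simp only [Int.cast_neg, Int.cast_one, Pi.single_neg, ← sub_eq_add_neg] at h
  simp only [adj, latticeFun, sampField, dq, PiLp.smul_apply, smul_eq_mul, h]
  field_simp

end Lattice

/-! ### The scaling limit -/

/-- Uniformly bounded linear functionals that converge on a total set converge everywhere. -/
theorem tendsto_inner_of_total {H : Type*} [NormedAddCommGroup H] [InnerProductSpace ℝ H]
    [CompleteSpace H] {ℓ : ℕ → H →ₗ[ℝ] ℝ} {C : ℝ} (hC : ∀ k F, |ℓ k F| ≤ C * ‖F‖) {v : H}
    {S : Set H} (hS : ∀ w : H, (∀ s ∈ S, inner ℝ w s = 0) → w = 0)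
    (h : ∀ s ∈ S, Tendsto (fun k => ℓ k s) atTop (𝓝 (inner ℝ v s))) (F : H) :
    Tendsto (fun k => ℓ k F) atTop (𝓝 (inner ℝ v F)) := by
  let P : Submodule ℝ H :=
    { carrier := {F | Tendsto (fun k => ℓ k F) atTop (𝓝 (inner ℝ v F))}
      zero_mem' := by simp
      add_mem' := by
        intro F G hF hG
        simpa [inner_add_right] using Tendsto.add hF hG
      smul_mem' := by
        intro c F hF
        simpa [inner_smul_right] using Tendsto.const_mul c hF }
  have hdense : (Submodule.span ℝ S).topologicalClosure = ⊤ := by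
    rw [Submodule.topologicalClosure_eq_top_iff, Submodule.eq_bot_iff]
    intro w hw
    refine hS w fun s hs => ?_
    rw [real_inner_comm]
    exact hw s (Submodule.subset_span hs)
  have hF : F ∈ closure (Submodule.span ℝ S : Set H) := by
    rw [← Submodule.topologicalClosure_coe, hdense]
    trivial
  rw [Metric.tendsto_atTop]
  intro δ hδ
  obtain ⟨G, hG, hFG⟩ := Metric.mem_closure_iff.1 hF (δ / 2 / (|C| + ‖v‖ + 1)) (by positivity)
  have hGP : G ∈ P := (Submodule.span_le.2 fun s hs => h s hs) hG
  obtain ⟨N, hN⟩ := Metric.tendsto_atTop.1 (show Tendsto _ _ _ from hGP) (δ / 2) (by positivity)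
  refine ⟨N, fun k hk => ?_⟩
  have h1 := hN k hk
  rw [dist_eq_norm, lt_div_iff₀ (by positivity)] at hFG
  rw [Real.dist_eq] at h1 ⊢
  have h2 : ℓ k F - inner ℝ v F =
      ℓ k (F - G) + (ℓ k G - inner ℝ v G) - inner ℝ v (F - G) := by
    rw [map_sub, inner_sub_right]; ring
  rw [h2]
  have h3 : |ℓ k (F - G)| ≤ |C| * ‖F - G‖ :=
    (hC k _).trans (mul_le_mul_of_nonneg_right (le_abs_self C) (norm_nonneg _))
  have h4 := abs_real_inner_le_norm v (F - G)
  refine (abs_sub _ _).trans_lt ?_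
  have h5 := abs_add_le (ℓ k (F - G)) (ℓ k G - inner ℝ v G)
  nlinarith [norm_nonneg (F - G)]

section Scaling

variable {d : ℕ}

/-- The linear map `w ↦ w_j e_i - w_i e_j`; applied to gradients it yields the fields that are
orthogonal to all gradients. -/
noncomputable def curlMap (i j : Fin d) : E d →L[ℝ] E d :=
  (EuclideanSpace.proj j : E d →L[ℝ] ℝ).smulRight (EuclideanSpace.single i 1) -
    (EuclideanSpace.proj i : E d →L[ℝ] ℝ).smulRight (EuclideanSpace.single j 1)

theorem inner_curlMap (i j : Fin d) (v w : E d) :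
    inner ℝ v (curlMap i j w) = v i * w j - v j * w i := by
  simp [curlMap, inner_sub_right, inner_smul_right, EuclideanSpace.inner_single_right, mul_comm]

theorem sampField_clm {n : ℕ} (T : E d →L[ℝ] E d) (ε : ℝ) (f : E d → E d) (x : Torus d n) :
    sampField ε (fun y => T (f y)) x = T (sampField ε f x) := by
  simp [sampField]

/-- The curl field of `ψ` discretized with backward differences is exactly orthogonal to discrete
gradients. -/
theorem sum_inner_curlMap {n : ℕ} [NeZero n] {ψ : E d → ℝ} {R ε : ℝ} (hε : 0 < ε)
    (hR : ∀ y, R < ‖y‖ → ψ y = 0) (hn : 2 * R < ε * ((n : ℝ) - 2)) (i j : Fin d)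
    (φ : Torus d n → ℝ) :
    ∑ x, inner ℝ (sampField ε (fun y => curlMap i j (dq (-1 * ε) ψ y)) x) (grad φ x) = 0 := by
  have h : ∀ x, inner ℝ (sampField ε (fun y => curlMap i j (dq (-1 * ε) ψ y)) x) (grad φ x) =
      adj i (latticeFun ε ψ) x * fwd j φ x - adj j (latticeFun ε ψ) x * fwd i φ x := by
    intro x
    rw [sampField_clm, real_inner_comm, inner_curlMap, adj_latticeFun hε hR hn,
      adj_latticeFun hε hR hn, grad_apply, grad_apply]
    ring
  simp only [h, Finset.sum_sub_distrib]
  rw [sum_adj_mul_fwd_comm, sub_self]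

variable {n : ℕ → ℕ} [∀ k, NeZero (n k)] {ε : ℕ → ℝ} {q : ℕ → Matrix (Fin d) (Fin d) ℝ}
  {qbar : Matrix (Fin d) (Fin d) ℝ}

/-- The pairing of averaged fields with a fixed field on the torus, as a functional on `L²`. -/
noncomputable def avgFunctional {m : ℕ} [NeZero m] {t : ℝ} (ht : 0 < t) (g : Torus d m → E d) :
    Lp (E d) 2 (volume : Measure (E d)) →ₗ[ℝ] ℝ where
  toFun F := ∑ x, inner ℝ (avgField t F x) (g x)
  map_add' F G := by
    rw [← Finset.sum_add_distrib, avgField_congr (Lp.coeFn_add F G)]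
    refine Finset.sum_congr rfl fun x _ => ?_
    rw [avgField_add ht (Lp.memLp F) (Lp.memLp G), inner_add_left]
  map_smul' c F := by
    rw [avgField_congr (Lp.coeFn_smul c F), smul_eq_mul, Finset.mul_sum]
    refine Finset.sum_congr rfl fun x _ => ?_
    rw [avgField_smul ht, inner_smul_left]
    rfl

theorem avgFunctional_apply {m : ℕ} [NeZero m] {t : ℝ} (ht : 0 < t) (g : Torus d m → E d)
    {F : Lp (E d) 2 (volume : Measure (E d))} {G : E d → E d} (h : F =ᵐ[volume] G) :
    avgFunctional ht g F = ∑ x, inner ℝ (avgField t G x) (g x) := by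
  rw [← avgField_congr h]; rfl

theorem abs_avgFunctional_le {m : ℕ} [NeZero m] {t : ℝ} (ht : 0 < t) (g : Torus d m → E d)
    (F : Lp (E d) 2 (volume : Measure (E d))) :
    |avgFunctional ht g F| ≤ l2norm g * ‖F‖ := by
  refine (abs_sum_inner_le (avgField t F) g).trans ?_
  have h := l2norm_avgField_le (n := m) ht (Lp.memLp F)
  rw [Lp.toLp_coeFn] at h
  rw [mul_comm]
  exact mul_le_mul_of_nonneg_left h (l2norm_nonneg g)

/-- Replacing averages by samples does not change the limit of the pairing with a bounded family
of fields. -/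
theorem SampleConv.tendsto_sum_inner_sub {f : ℕ → E d → E d} {F : E d → E d}
    (h : SampleConv ε f F) (hε : ∀ k, 0 < ε k) (hε1 : ∀ k, ε k ≤ 1)
    {g : ∀ k, Torus d (n k) → E d} {C : ℝ} (hg : ∀ k, l2norm (g k) ≤ C) :
    Tendsto (fun k => ∑ x, inner ℝ (avgField (ε k) F x) (g k x) -
      ∑ x, inner ℝ (sampField (ε k) (f k) x) (g k x)) atTop (𝓝 0) := by
  have h1 := (h.tendsto_l2norm (n := n) hε hε1).mul_const C
  rw [zero_mul] at h1
  refine squeeze_zero_norm (fun k => ?_) h1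
  rw [← Finset.sum_sub_distrib, Real.norm_eq_abs, ← abs_neg, ← Finset.sum_neg_distrib]
  have h2 : ∀ x : Torus d (n k), -(inner ℝ (avgField (ε k) F x) (g k x) -
      inner ℝ (sampField (ε k) (f k) x) (g k x)) =
      (inner ℝ (sampField (ε k) (f k) x - avgField (ε k) F x) (g k x) : ℝ) := fun x => by
    rw [inner_sub_left]; ring
  simp only [h2]
  exact (abs_sum_inner_le (fun x => sampField (ε k) (f k) x - avgField (ε k) F x) (g k)).trans
    (mul_le_mul_of_nonneg_left (hg k) (l2norm_nonneg _))

theorem SampleConv.exists_l2norm_le {f : ℕ → E d → E d} {F : E d → E d}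
    (h : SampleConv ε f F) (hε : ∀ k, 0 < ε k) (hε1 : ∀ k, ε k ≤ 1) :
    ∃ C, ∀ k, l2norm (sampField (ε k) (f k) : Torus d (n k) → E d) ≤ C := by
  obtain ⟨C, hC⟩ := (h.tendsto_l2norm (n := n) hε hε1).bddAbove_range
  refine ⟨‖(h.memLp hε hε1).toLp F‖ + C, fun k => ?_⟩
  refine (l2norm_le_add_sub _ (avgField (ε k) F)).trans (add_le_add ?_ (hC ⟨k, rfl⟩))
  exact l2norm_avgField_le (hε k) _

/-- In the limit, gradients on the tori are orthogonal to the curl fields. -/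
theorem tendsto_sum_inner_curl (hε : ∀ k, 0 < ε k) (hε1 : ∀ k, ε k ≤ 1)
    (hε0 : Tendsto ε atTop (𝓝 0)) (hn : Tendsto (fun k => ε k * ((n k : ℝ) - 2)) atTop atTop)
    {φ : ∀ k, Torus d (n k) → ℝ} {C : ℝ} (hφ : ∀ k, l2norm (grad (φ k)) ≤ C)
    {ψ : E d → ℝ} (hψ : IsTest ψ) {R : ℝ} (hR : ∀ y, R < ‖y‖ → ψ y = 0) (i j : Fin d) :
    Tendsto (fun k => ∑ x, inner ℝ (avgField (ε k) (fun y => curlMap i j (gradE ψ y)) x)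
      (grad (φ k) x)) atTop (𝓝 0) := by
  have hsc := sampleConv_dq hψ (curlMap i j) hε hε1 hε0 (s := -1) (by simp)
  refine (hsc.tendsto_sum_inner_sub hε hε1 hφ).congr' ?_
  filter_upwards [hn.eventually_gt_atTop (2 * R)] with k hk
  rw [sum_inner_curlMap (hε k) hR hk, sub_zero]

/-- The discrete equation tested with the restriction of `ψ` to the lattice. The matrix `q k` may be
replaced by its limit because the gradients involved are bounded in `ℓ²`. -/
theorem tendsto_sum_inner_equation (hε : ∀ k, 0 < ε k) (hε1 : ∀ k, ε k ≤ 1)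
    (hε0 : Tendsto ε atTop (𝓝 0)) (hn : Tendsto (fun k => ε k * ((n k : ℝ) - 2)) atTop atTop)
    (hq : ∀ k, opNorm (q k) ≤ 1 / 2)
    (hlim : Tendsto (fun k => opNorm (q k - qbar)) atTop (𝓝 0)) {J : E d → E d}
    (hJ : MemLp J 2 volume) {ψ : E d → ℝ} (hψ : IsTest ψ) {R : ℝ}
    (hR : ∀ y, R < ‖y‖ → ψ y = 0) :
    Tendsto (fun k => ∑ x : Torus d (n k), inner ℝ
      (avgField (ε k) (fun y => Matrix.toEuclideanCLM (n := Fin d) (𝕜 := ℝ) (1 + qbar)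
        (gradE ψ y)) x) (covGrad (q k) (avgField (ε k) J) x)) atTop
      (𝓝 (∫ y, inner ℝ (J y) (gradE ψ y))) := by
  set A : E d →L[ℝ] E d := Matrix.toEuclideanCLM (n := Fin d) (𝕜 := ℝ) (1 + qbar) with hA
  set g : ∀ k, Torus d (n k) → E d := fun k => covGrad (q k) (avgField (ε k) J) with hg
  have hgC : ∀ k, l2norm (g k) ≤ 2 * ‖hJ.toLp J‖ := fun k =>
    (l2norm_covGrad_le (hq k) _).trans
      (mul_le_mul_of_nonneg_left (l2norm_avgField_le (hε k) hJ) two_pos.le)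
  have hscA := sampleConv_dq hψ A hε hε1 hε0 (s := 1) (by simp)
  have hsc := sampleConv_dq hψ (ContinuousLinearMap.id ℝ (E d)) hε hε1 hε0 (s := 1) (by simp)
  simp only [ContinuousLinearMap.id_apply, one_mul] at hsc hscA
  have hn1 : Tendsto (fun k => ε k * ((n k : ℝ) - 1)) atTop atTop :=
    tendsto_atTop_mono (fun k => mul_le_mul_of_nonneg_left (by linarith) (hε k).le) hn
  obtain ⟨C, hC⟩ := hsc.exists_l2norm_le (n := n) hε hε1
  have h1 := hscA.tendsto_sum_inner_sub hε hε1 hgC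
  have h2 := hsc.tendsto_sum_inner (n := n) hε hε1 hn1 hJ
  -- The error from replacing `q k` by `qbar` in the discrete equation.
  have h3 : Tendsto (fun k => ∑ x, ∑ i, ∑ j, (q k - qbar) i j * g k x i *
      sampField (ε k) (dq (ε k) ψ) x j) atTop (𝓝 0) := by
    have h4 := hlim.mul_const (2 * ‖hJ.toLp J‖ * C)
    rw [zero_mul] at h4
    refine squeeze_zero_norm (fun k => ?_) h4
    rw [Real.norm_eq_abs]
    calc _ ≤ ∑ x, opNorm (q k - qbar) * (‖g k x‖ * ‖sampField (ε k) (dq (ε k) ψ) x‖) := by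
          refine (Finset.abs_sum_le_sum_abs _ _).trans (Finset.sum_le_sum fun x _ => ?_)
          rw [← mul_assoc]
          exact abs_sum_mul_le _ _ _
      _ ≤ opNorm (q k - qbar) * (2 * ‖hJ.toLp J‖ * C) := by
          rw [← Finset.mul_sum]
          refine mul_le_mul_of_nonneg_left ((sum_norm_mul_norm_le _ _).trans ?_) (opNorm_nonneg _)
          exact mul_le_mul (hgC k) (hC k) (l2norm_nonneg _) (by positivity)
  have h5 := (h1.add h2).sub h3
  rw [zero_add, sub_zero] at h5
  refine h5.congr' ?_
  filter_upwards [hn.eventually_gt_atTop (2 * R)] with k hk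
  have e1 := sum_covGrad_mul_grad (hq k) (avgField (ε k) J) (latticeFun (ε k) ψ : Torus d (n k) → ℝ)
  simp only [grad_latticeFun (hε k) hR hk] at e1
  have e2 : ∑ x, inner ℝ (sampField (ε k) (fun y => A (dq (ε k) ψ y)) x) (g k x) =
      ∑ x, ∑ i, ∑ j, (1 + qbar) i j * g k x i * sampField (ε k) (dq (ε k) ψ) x j := by
    refine Finset.sum_congr rfl fun x _ => ?_
    rw [sampField_clm, real_inner_comm, hA, ← sum_mul_eq_inner]
  rw [← e1, e2, sub_add_eq_add_sub, sub_sub, add_sub_assoc, add_eq_left, sub_eq_zero,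
    ← Finset.sum_add_distrib]
  refine Finset.sum_congr rfl fun x _ => ?_
  rw [← Finset.sum_add_distrib]
  refine Finset.sum_congr rfl fun i _ => ?_
  rw [← Finset.sum_add_distrib]
  refine Finset.sum_congr rfl fun j _ => ?_
  simp only [Matrix.add_apply, Matrix.sub_apply]
  ring

/-- Convergence of the covariance form for averaged fields. -/
theorem tendsto_covForm_avgField (hd : 1 ≤ d) (hε : ∀ k, 0 < ε k) (hε1 : ∀ k, ε k ≤ 1)
    (hε0 : Tendsto ε atTop (𝓝 0)) (hn : Tendsto (fun k => ε k * ((n k : ℝ) - 2)) atTop atTop)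
    (hq : ∀ k, opNorm (q k) ≤ 1 / 2)
    (hlim : Tendsto (fun k => opNorm (q k - qbar)) atTop (𝓝 0)) (hsymm : qbar.IsSymm)
    (hqbar : opNorm qbar ≤ 1 / 2) {Ja Jb : E d → E d}
    (hJa : MemLp Ja 2 volume) (hJb : MemLp Jb 2 volume) {u : E d → ℝ} {v : E d → E d}
    (hv : IsSolution (1 + qbar) Jb u v) :
    Tendsto (fun k => covForm (q k) (avgField (ε k) Ja : Torus d (n k) → E d)
      (avgField (ε k) Jb)) atTop (𝓝 (∫ y, inner ℝ (Ja y) (v y))) := by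
  set A : E d →L[ℝ] E d := Matrix.toEuclideanCLM (n := Fin d) (𝕜 := ℝ) (1 + qbar) with hA
  set g : ∀ k, Torus d (n k) → E d := fun k => covGrad (q k) (avgField (ε k) Jb) with hg
  have hgC : ∀ k, l2norm (g k) ≤ 2 * ‖hJb.toLp Jb‖ := fun k =>
    (l2norm_covGrad_le (hq k) _).trans
      (mul_le_mul_of_nonneg_left (l2norm_avgField_le (hε k) hJb) two_pos.le)
  have hvm := hv.memLp_grad
  set S : Set (Lp (E d) 2 (volume : Measure (E d))) :=
    {F | ∃ ψ, IsTest ψ ∧ (F =ᵐ[volume] (fun y => A (gradE ψ y)) ∨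
      ∃ i j, F =ᵐ[volume] fun y => curlMap i j (gradE ψ y))} with hSdef
  have hmem : ∀ (T : E d →L[ℝ] E d) {ψ : E d → ℝ}, IsTest ψ →
      MemLp (fun y => T (gradE ψ y)) 2 volume := fun T _ h => T.comp_memLp' h.memLp_gradE
  have hinner : ∀ (w : E d → E d) (ψ : E d → ℝ) (y : E d),
      ∑ i, ∑ j, (1 + qbar) i j * w y i * pd j ψ y = inner ℝ (w y) (A (gradE ψ y)) :=
    fun w ψ y => sum_mul_eq_inner _ (w y) (gradE ψ y)
  have hS : ∀ w : Lp (E d) 2 (volume : Measure (E d)),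
      (∀ s ∈ S, inner ℝ w s = 0) → w = 0 := by
    intro w hw
    have hT : ∀ (T : E d →L[ℝ] E d) {ψ : E d → ℝ} (hψ : IsTest ψ), (hmem T hψ).toLp _ ∈ S →
        ∫ y, inner ℝ (w y) (T (gradE ψ y)) = 0 := by
      intro T ψ hψ hmS
      have h1 := hw _ hmS
      rw [L2.inner_def] at h1
      rw [← h1]
      refine integral_congr_ae ?_
      filter_upwards [(hmem T hψ).coeFn_toLp] with y hy
      rw [hy]
    refine Lp.ext ((ae_eq_zero_of_curl_free (posSemidef_one_add hsymm hqbar)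
      (trace_one_add_pos hd hqbar) (Lp.memLp w) (fun ψ hψ i j => ?_) fun ψ hψ => ?_).trans
      (Lp.coeFn_zero _ _ _).symm)
    · have h1 := hT (curlMap i j) hψ ⟨ψ, hψ, Or.inr ⟨i, j, (hmem _ hψ).coeFn_toLp⟩⟩
      simp only [inner_curlMap, gradE_apply] at h1
      rwa [integral_sub (integrable_mul_of_memLp (memLp_coord (Lp.memLp w) i) (hψ.pd j).memLp)
        (integrable_mul_of_memLp (memLp_coord (Lp.memLp w) j) (hψ.pd i).memLp),
        sub_eq_zero] at h1
    · simp only [hinner]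
      exact hT A hψ ⟨ψ, hψ, Or.inl (hmem _ hψ).coeFn_toLp⟩
  have hconv : ∀ s ∈ S, Tendsto (fun k => avgFunctional (hε k) (g k) s) atTop
      (𝓝 (inner ℝ (hvm.toLp v) s)) := by
    have hval : ∀ {s : Lp (E d) 2 (volume : Measure (E d))} {G : E d → E d}, s =ᵐ[volume] G →
        inner ℝ (hvm.toLp v) s = ∫ y, inner ℝ (v y) (G y) := by
      intro s G hs
      rw [L2.inner_def]
      refine integral_congr_ae ?_
      filter_upwards [hs, hvm.coeFn_toLp] with y h1 h2
      rw [h1, h2]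
    rintro s ⟨ψ, hψ, hs | ⟨i, j, hs⟩⟩
    · obtain ⟨R, hR⟩ := exists_radius hψ.2
      have h1 := tendsto_sum_inner_equation hε hε1 hε0 hn hq hlim hJb hψ hR
      have h2 := hv.equation ψ hψ
      simp only [hinner] at h2
      rw [hval hs, h2]
      simp only [avgFunctional_apply _ _ hs]
      convert h1 using 4
      rw [PiLp.inner_apply]
      simp [mul_comm]
    · obtain ⟨R, hR⟩ := exists_radius hψ.2
      rw [hval hs]
      simp only [avgFunctional_apply _ _ hs, inner_curlMap, gradE_apply]
      rw [integral_sub (integrable_mul_of_memLp (memLp_coord hvm i) (hψ.pd j).memLp)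
        (integrable_mul_of_memLp (memLp_coord hvm j) (hψ.pd i).memLp), hv.curl_free hψ i j,
        sub_self]
      exact tendsto_sum_inner_curl hε hε1 hε0 hn hgC hψ hR i j
  have hmain := tendsto_inner_of_total
    (fun k F => (abs_avgFunctional_le (hε k) (g k) F).trans
      (mul_le_mul_of_nonneg_right (hgC k) (norm_nonneg F))) hS hconv (hJa.toLp Ja)
  have hfin : inner ℝ (hvm.toLp v) (hJa.toLp Ja) = ∫ y, inner ℝ (Ja y) (v y) := by
    rw [L2.inner_def]
    refine integral_congr_ae ?_
    filter_upwards [hJa.coeFn_toLp, hvm.coeFn_toLp] with y h1 h2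
    rw [h1, h2, real_inner_comm]
  rw [hfin] at hmain
  refine hmain.congr fun k => ?_
  rw [avgFunctional_apply _ _ hJa.coeFn_toLp, covForm_eq]

theorem SuppReg.sampleConv {z : E d} {J : E d → E d} (h : SuppReg z J) (hε : ∀ k, 0 < ε k)
    (hε0 : Tendsto ε atTop (𝓝 0)) : SampleConv ε (fun _ => J) J := by
  obtain ⟨⟨M, hM⟩, hc, hs, -⟩ := h
  refine ⟨⟨M, fun _ => hM⟩, ?_, ?_⟩
  · obtain ⟨R, hR⟩ := exists_radius hs
    exact ⟨R, fun _ => hR⟩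
  · filter_upwards [hc] with y hy
    exact hy.tendsto.comp (tendsto_rnd hε hε0 y)

/-- The covariance forms of samples and of averages have the same limit. -/
theorem tendsto_covForm_sub (hε : ∀ k, 0 < ε k) (hε1 : ∀ k, ε k ≤ 1)
    (hq : ∀ k, opNorm (q k) ≤ 1 / 2) {Ja Jb : E d → E d}
    (ha : SampleConv ε (fun _ => Ja) Ja) (hb : SampleConv ε (fun _ => Jb) Jb) :
    Tendsto (fun k => covForm (q k) (sampField (ε k) Ja : Torus d (n k) → E d)
      (sampField (ε k) Jb) - covForm (q k) (avgField (ε k) Ja : Torus d (n k) → E d)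
      (avgField (ε k) Jb)) atTop (𝓝 0) := by
  obtain ⟨C, hC⟩ := hb.exists_l2norm_le (n := n) hε hε1
  have h1 := ha.tendsto_l2norm (n := n) hε hε1
  have h2 := hb.tendsto_l2norm (n := n) hε hε1
  set D := ‖(ha.memLp hε hε1).toLp Ja‖
  have h3 := ((h1.const_mul 2).mul_const C).add (h2.const_mul (2 * D))
  rw [mul_zero, zero_mul, mul_zero, add_zero] at h3
  refine squeeze_zero_norm (fun k => (abs_covForm_sub_le (hq k) _ _ _ _).trans ?_) h3
  refine add_le_add (mul_le_mul_of_nonneg_left (hC k) ?_)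
    (mul_le_mul_of_nonneg_right (mul_le_mul_of_nonneg_left ?_ two_pos.le) (l2norm_nonneg _))
  · exact mul_nonneg two_pos.le (l2norm_nonneg _)
  · exact l2norm_avgField_le (hε k) _

/-! ### The scales of the torus of side length `L ^ N` -/

theorem sqrt_scale_pow {L : ℕ} (hL : 1 < L) (α : ℝ) (N : ℕ) :
    √(((L : ℝ) ^ (-(α * N))) ^ d) = (L : ℝ) ^ (-(α * N * d / 2)) := by
  have hL0 : (0 : ℝ) < L := by positivity
  rw [Real.sqrt_eq_rpow, ← Real.rpow_natCast, ← Real.rpow_mul hL0.le, ← Real.rpow_mul hL0.le]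
  congr 1
  ring

theorem averaged_eq_avgField {L : ℕ} (hL : 1 < L) (α : ℝ) (N : ℕ) (J : E d → E d) :
    averaged L α N J = avgField ((L : ℝ) ^ (-(α * N))) J := by
  ext x : 1
  rw [averaged, avgField, sqrt_scale_pow hL]

theorem sampled_eq_sampField {L : ℕ} (hL : 1 < L) (α : ℝ) (N : ℕ) (J : E d → E d) :
    sampled L α N J = sampField ((L : ℝ) ^ (-(α * N))) J := by
  ext x : 1
  rw [sampled, sampField, sqrt_scale_pow hL]

theorem tendsto_scale {L : ℕ} (hL : 1 < L) {α : ℝ} (hα : 0 < α) :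
    Tendsto (fun N : ℕ => (L : ℝ) ^ (-(α * N))) atTop (𝓝 0) := by
  have hL1 : (1 : ℝ) < L := by exact_mod_cast hL
  refine (tendsto_rpow_atBot_of_base_gt_one _ hL1).comp ?_
  exact tendsto_neg_atTop_atBot.comp (tendsto_natCast_atTop_atTop.const_mul_atTop hα)

theorem tendsto_scale_mul {L : ℕ} (hL : 1 < L) {α : ℝ} (hα : 0 < α) (hα1 : α < 1) :
    Tendsto (fun N : ℕ => (L : ℝ) ^ (-(α * N)) * (((L ^ N : ℕ) : ℝ) - 2)) atTop atTop := by
  have hL1 : (1 : ℝ) < L := by exact_mod_cast hL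
  have hL0 : (0 : ℝ) < L := by linarith
  have h1 : Tendsto (fun N : ℕ => (L : ℝ) ^ ((1 - α) * N)) atTop atTop :=
    (tendsto_rpow_atTop_of_base_gt_one _ hL1).comp
      (tendsto_natCast_atTop_atTop.const_mul_atTop (sub_pos.2 hα1))
  have h2 := tendsto_atTop_add_const_right atTop (-2 : ℝ) h1
  refine tendsto_atTop_mono (fun N => ?_) h2
  have h3 : (L : ℝ) ^ (-(α * N)) ≤ 1 :=
    Real.rpow_le_one_of_one_le_of_nonpos hL1.le (by
      have : 0 ≤ α * N := by positivity
      linarith)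
  have h4 : (L : ℝ) ^ (-(α * N)) * ((L ^ N : ℕ) : ℝ) = (L : ℝ) ^ ((1 - α) * N) := by
    push_cast
    rw [← Real.rpow_natCast, ← Real.rpow_add hL0]
    congr 1
    ring
  rw [mul_sub, h4]
  linarith

end Scaling

end GradModel

theorem mainTheorem4 (d : ℕ) (hd : 1 ≤ d) (L : ℕ) [NeZero L] (hLodd : Odd L) (hL : 1 < L)
    (q : ℕ → Matrix (Fin d) (Fin d) ℝ) (hsymm : ∀ N, (q N).IsSymm)
    (hq : ∀ N, GradModel.opNorm (q N) ≤ 1 / 2) :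
    -- the operators `𝒜^{q_N}` are invertible on the functions of mean value zero
    (∀ N, IsUnit (GradModel.opA (d := d) (n := L ^ N) (q N))) ∧
    -- the parameters converge along a subsequence
    (∃ (qbar : Matrix (Fin d) (Fin d) ℝ) (κ : ℕ → ℕ), qbar.IsSymm ∧ StrictMono κ ∧
      Tendsto (fun k => GradModel.opNorm (q (κ k) - qbar)) atTop (𝓝 0)) ∧
    -- along every such subsequence the covariances converge
    (∀ (qbar : Matrix (Fin d) (Fin d) ℝ) (κ : ℕ → ℕ), StrictMono κ →
      Tendsto (fun k => GradModel.opNorm (q (κ k) - qbar)) atTop (𝓝 0) →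
      -- well-posedness of the limit equation
      (∀ J : GradModel.E d → GradModel.E d, MemLp J 2 volume →
        (∃ u v, GradModel.IsSolution (1 + qbar) J u v) ∧
        (∀ u v u' v', GradModel.IsSolution (1 + qbar) J u v →
          GradModel.IsSolution (1 + qbar) J u' v' →
          v =ᵐ[volume] v' ∧ ∃ c : ℝ, ∀ᵐ y, u y - u' y = c)) ∧
      ∀ α : ℝ, 0 < α → α < 1 → ∀ (a b : GradModel.E d)
        (Ja Jb : GradModel.E d → GradModel.E d),
        (GradModel.SuppL2 a Ja → GradModel.SuppL2 b Jb →
          ∀ u v, GradModel.IsSolution (1 + qbar) Jb u v →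
          Tendsto (fun k => GradModel.covForm (q (κ k))
              (GradModel.averaged L α (κ k) Ja) (GradModel.averaged L α (κ k) Jb))
            atTop (𝓝 (∫ y, inner ℝ (Ja y) (v y)))) ∧
        (GradModel.SuppReg a Ja → GradModel.SuppReg b Jb →
          ∀ u v, GradModel.IsSolution (1 + qbar) Jb u v →
          Tendsto (fun k => GradModel.covForm (q (κ k))
              (GradModel.sampled L α (κ k) Ja) (GradModel.sampled L α (κ k) Jb))
            atTop (𝓝 (∫ y, inner ℝ (Ja y) (v y))))) := by
  refine ⟨fun N => GradModel.isUnit_opA (hq N), ?_, fun qbar κ hκ hlim => ?_⟩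
  · obtain ⟨qbar, κ, hκ, hlim⟩ := GradModel.exists_subseq_tendsto hq
    exact ⟨qbar, κ, GradModel.isSymm_of_tendsto (fun k => hsymm (κ k)) hlim, hκ, hlim⟩
  have hs : qbar.IsSymm := GradModel.isSymm_of_tendsto (fun k => hsymm (κ k)) hlim
  have hqb : GradModel.opNorm qbar ≤ 1 / 2 :=
    GradModel.opNorm_le_of_tendsto (fun k => hq (κ k)) hlim
  refine ⟨fun J hJ => ⟨GradModel.exists_isSolution hqb hJ, fun u v u' v' h h' =>
    GradModel.isSolution_unique hd hs hqb h h'⟩, fun α hα hα1 a b Ja Jb => ?_⟩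
  have hL1 : (1 : ℝ) < L := by exact_mod_cast hL
  have hε : ∀ k, 0 < (L : ℝ) ^ (-(α * (κ k : ℕ))) := fun k => by positivity
  have hε1 : ∀ k, (L : ℝ) ^ (-(α * (κ k : ℕ))) ≤ 1 := fun k =>
    Real.rpow_le_one_of_one_le_of_nonpos hL1.le (by
      have : 0 ≤ α * (κ k : ℕ) := by positivity
      linarith)
  have hε0 := (GradModel.tendsto_scale hL hα).comp hκ.tendsto_atTop
  have hn := (GradModel.tendsto_scale_mul hL hα hα1).comp hκ.tendsto_atTop
  refine ⟨fun ha hb u v hv => ?_, fun ha hb u v hv => ?_⟩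
  · simp only [GradModel.averaged_eq_avgField hL]
    exact GradModel.tendsto_covForm_avgField (n := fun k => L ^ κ k) hd hε hε1 hε0 hn
      (fun k => hq (κ k)) hlim hs hqb ha.1 hb.1 hv
  · simp only [GradModel.sampled_eq_sampField hL]
    have hca := ha.sampleConv hε hε0
    have hcb := hb.sampleConv hε hε0
    have h1 := GradModel.tendsto_covForm_avgField (n := fun k => L ^ κ k) hd hε hε1 hε0 hn
      (fun k => hq (κ k)) hlim hs hqb (hca.memLp hε hε1) (hcb.memLp hε hε1) hv
    have h2 := GradModel.tendsto_covForm_sub (n := fun k => L ^ κ k) hε hε1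
      (fun k => hq (κ k)) hca hcb
    have h3 := h2.add h1
    rw [zero_add] at h3
    exact h3.congr fun k => sub_add_cancel _ _
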